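/- **Setting.** Let $n\ge 3$ and let $f:[0,1]^2\to[0,1]$ be a symmetric function for which there are a constant $L$ and a finite partition of $[0,1]^2$ into rectangles (products of intervals) such that, on each rectangle, $f$ is $L$-Lipschitz in each argument. Let $\xi_1,\dots,\xi_n$ be i.i.d. uniform on $[0,1]$ and $P_{kl}=f(\xi_k,\xi_l)$. Let $A$ be the adjacency matrix of a random undirected simple graph on $\{1,\dots,n\}$ ($A_{kl}=A_{lk}\in\{0,1\}$, $A_{kk}=0$) such that, conditionally on $P=(P_{kl})$, the entries $A_{kl}$, $k<l$, are independent with $A_{kl}\sim\mathrm{Bernoulli}(P_{kl})$. For a node $j$ let $A^{(-j)}$ be $A$ with row and column $j$ deleted and $M^{(-j)}=\frac1{n-1}(A^{(-j)})^2$. For $i\ne j$ and $k\notin\{i,j\}$ put $d^{(-j)}(i,k)=\max_{l\ne j}|M^{(-j)}_{il}-M^{(-j)}_{kl}|$. For a bandwidth $h_n\in\{1,\dots,n-2\}$, the leave-one-out neighbourhood $\mathcal N_i^{(-j)}$ is the set of the $h_n$ nodes $k\notin\{i,j\}$ with the smallest $d^{(-j)}(i,k)$, ties being broken in favour of the smaller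 index. Let $$U_{ij}=\frac1{h_n}\sum_{k\in\mathcal N_i^{(-j)}}(A_{kj}-P_{kj}),\qquad V_{ij}=\operatorname{Var}\big(U_{ij}\mid \mathcal N_i^{(-j)},P\big),$$ and let $\Phi$ be the standard normal distribution function. **Theorem 3.2 (Uniform Berry–Esseen bound).** For every $\eta\in(0,1/2)$ there is a constant $C>0$, depending only on $\eta$, such that the following holds. For every $n$, every bandwidth $1\le h_n\le n-2$ (in particular along every sequence $h_n\to\infty$ of such bandwidths), every $L$ and every $f$ as above with $\eta\le f(u,v)\le 1-\eta$ for all $(u,v)\in[0,1]^2$, and every such random graph, almost surely $$\sup_{\substack{1\le i,j\le n\\ i\ne j}}\ \sup_{x\in\mathbb R}\left|\,\mathbb P\!\left(\frac{U_{ij}}{\sqrt{V_{ij}}}\le x\ \middle|\ \mathcal N_i^{(-j)},P\right)-\Phi(x)\right|\le C\,h_n^{-1/2},$$ where $\mathbb P(\,\cdot\mid \mathcal N_i^{(-j)},P)$ is the regular conditional distribution of $U_{ij}/\sqrt{V_{ij}}$. -/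

import Mathlib

open MeasureTheory ProbabilityTheory

noncomputable section

/-- `f : [0,1]² → ℝ` is piecewise Lipschitz in each argument with constant `L`: there is a finite
partition of `[0,1]²` into rectangles `S r × T r` (products of intervals, which may be open, closed,
half-open or degenerate) such that on every rectangle `f` is `L`-Lipschitz in the first argument and
`L`-Lipschitz in the second argument. -/
def PiecewiseLipschitz (f : unitInterval → unitInterval → ℝ) (L : ℝ) : Prop :=
  ∃ (m : ℕ) (S T : Fin m → Set unitInterval),
    (∀ r, (S r).OrdConnected ∧ (T r).OrdConnected) ∧
    (⋃ r, S r ×ˢ T r) = Set.univ ∧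
    Pairwise (fun r s => Disjoint (S r ×ˢ T r) (S s ×ˢ T s)) ∧
    (∀ r, ∀ u ∈ S r, ∀ u' ∈ S r, ∀ v ∈ T r, |f u v - f u' v| ≤ L * |(u : ℝ) - u'|) ∧
    (∀ r, ∀ u ∈ S r, ∀ v ∈ T r, ∀ v' ∈ T r, |f u v - f u v'| ≤ L * |(v : ℝ) - v'|)

/-- A graphon: a symmetric function `[0,1]² → [0,1]`, piecewise Lipschitz with constant `L`. -/
structure IsLipschitzGraphon (f : unitInterval → unitInterval → ℝ) (L : ℝ) : Prop where
  mem_Icc : ∀ u v, f u v ∈ Set.Icc (0 : ℝ) 1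
  symm : ∀ u v, f u v = f v u
  piecewiseLipschitz : PiecewiseLipschitz f L

/-- The random matrix of edge probabilities `P k l = f (ξ k) (ξ l)`. -/
def edgeProb {Ω : Type*} {n : ℕ} (f : unitInterval → unitInterval → ℝ)
    (ξ : Fin n → Ω → unitInterval) (ω : Ω) : Fin n → Fin n → ℝ :=
  fun k l => f (ξ k ω) (ξ l ω)

/-- The graphon model on `n` vertices: the latent positions `ξ k` are i.i.d. uniform on `[0,1]`, `A`
is the adjacency matrix of a random undirected simple graph, and conditionally on `P` the entries
`A k l`, `k < l`, are independent Bernoulli variables with parameters `P k l`. The last property is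
stated through the conditional joint mass function of the upper-triangular entries. -/
structure IsGraphonModel {Ω : Type*} [MeasurableSpace Ω] (μ : Measure Ω) {n : ℕ}
    (f : unitInterval → unitInterval → ℝ) (ξ : Fin n → Ω → unitInterval)
    (A : Ω → Matrix (Fin n) (Fin n) ℝ) : Prop where
  measurable_latent : ∀ k, Measurable (ξ k)
  indep_latent : iIndepFun ξ μ
  uniform_latent : ∀ k, μ.map (ξ k) = volume
  measurable_adj : ∀ k l, Measurable fun ω => A ω k l
  adj_zero_or_one : ∀ ω k l, A ω k l = 0 ∨ A ω k l = 1
  adj_symm : ∀ ω k l, A ω k l = A ω l k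
  adj_diag : ∀ ω k, A ω k k = 0
  cond_law : ∀ a : Fin n → Fin n → Bool,
    μ[Set.indicator {ω | ∀ k l, k < l → A ω k l = if a k l then 1 else 0} (fun _ => (1 : ℝ)) |
        MeasurableSpace.comap (edgeProb f ξ) inferInstance]
      =ᵐ[μ] fun ω => ∏ k, ∏ l ∈ Finset.Ioi k,
        if a k l then edgeProb f ξ ω k l else 1 - edgeProb f ξ ω k l

/-- The leave-one-out two-hop matrix `(A^(-j))² / (n - 1)`, where `A^(-j)` is `A` with row and
column `j` deleted. -/
def looTwoHop {n : ℕ} (A : Matrix (Fin n) (Fin n) ℝ) (j : Fin n) :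
    Matrix {v : Fin n // v ≠ j} {v : Fin n // v ≠ j} ℝ :=
  ((n : ℝ) - 1)⁻¹ • (A.submatrix Subtype.val Subtype.val) ^ 2

/-- The leave-one-out distance: the maximum over all `l ≠ j` of the difference of rows `i`, `k` of
the leave-one-out two-hop matrix. -/
def looDist {n : ℕ} (A : Matrix (Fin n) (Fin n) ℝ) (j : Fin n) (i k : {v : Fin n // v ≠ j}) : ℝ :=
  Finset.univ.sup' ⟨i, Finset.mem_univ i⟩ fun l => |looTwoHop A j i l - looTwoHop A j k l|

/-- The leave-one-out neighbourhood of `i`: sort the nodes `k ∉ {i, j}` by their distance to `i`,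
ties broken in favour of the smaller index, and take the first `h`. -/
def looNeighborhood {n : ℕ} (h : ℕ) (A : Matrix (Fin n) (Fin n) ℝ) (j : Fin n)
    (i : {v : Fin n // v ≠ j}) : Finset {v : Fin n // v ≠ j} :=
  (((((Finset.univ.erase i).image fun k => toLex (looDist A j i k, k)).sort).take h).map
    fun p => (ofLex p).2).toFinset

section Statistics

variable {Ω : Type*} {n : ℕ} (h : ℕ) (f : unitInterval → unitInterval → ℝ)
  (ξ : Fin n → Ω → unitInterval) (A : Ω → Matrix (Fin n) (Fin n) ℝ)
  (j : Fin n) (i : {v : Fin n // v ≠ j})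

/-- The conditioning variable: the neighbourhood of `i` together with `P`. -/
def looCond (ω : Ω) : Finset {v : Fin n // v ≠ j} × (Fin n → Fin n → ℝ) :=
  (looNeighborhood h (A ω) j i, edgeProb f ξ ω)

/-- The stochastic fluctuation `U = h⁻¹ ∑ (A k j - P k j)`, summed over the neighbourhood. -/
def looFluct (ω : Ω) : ℝ :=
  (h : ℝ)⁻¹ * ∑ k ∈ looNeighborhood h (A ω) j i, (A ω k j - edgeProb f ξ ω k j)

/-- The conditional variance `V` of `U` given the neighbourhood and `P`. -/
def looVar [MeasurableSpace Ω] (μ : Measure Ω) : Ω → ℝ :=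
  condVar (MeasurableSpace.comap (looCond h f ξ A j i) inferInstance) (looFluct h f ξ A j i) μ

/-- The standardized fluctuation `U / √V`. -/
def looStd [MeasurableSpace Ω] (μ : Measure Ω) (ω : Ω) : ℝ :=
  looFluct h f ξ A j i ω / √(looVar h f ξ A j i μ ω)

end Statistics

end

/-! The edges at `j` take no part in choosing the leave-one-out neighbourhood. So for a fixed `P`
and a fixed candidate set `S`, the event that the neighbourhood equals `S` does not depend on the
Bernoulli variables `A k j`, `k ∈ S`. On that event the fluctuation is a sum of centred independent
Bernoulli variables, and its conditional variance is `h⁻² ∑ P k j (1 - P k j)`, at least `h⁻¹ η (1 -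
η)`. A Berry–Esseen bound for such sums then gives the rate `h ^ (-1/2)`.

The Berry–Esseen bound is proved by Stein's method. Let `W` be the sum divided by its standard
deviation `s`. Averaging over one coordinate at a time expresses `E[W f(W)]` through increments of
`f` over intervals of length `s⁻¹`, each of which contains `W` (`bernExp_mul_stein`). For the Stein
solution of the half-line at `z`, such an increment is compared with the right-hand side of the
Stein equation at `W` itself. The jump of the indicator is absorbed by moving the threshold by `s⁻¹`
(`le_steinSol_sub`, `steinSol_sub_le`), which changes `Φ` by at most `s⁻¹`; no separate
concentration inequality is needed. Everything carries a nonnegative weight `G` independent of the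
summed coordinates (`abs_bernExp_indicator_sub_le`), and `G` is later the indicator of a
neighbourhood.

The passage to the model is `IsGraphonModel.condExp_nonneg`: a conditional expectation given the
neighbourhood and `P` is nonnegative once the corresponding finite Bernoulli sums, weighted by each
neighbourhood indicator, are. It yields the conditional variance and, for each threshold, the normal
approximation. Rational thresholds and right-continuity give all thresholds outside a single null
set. -/

/-! ### The standard normal law and Mills' inequality -/

/-- The standard normal density. -/
noncomputable abbrev normalPDF (x : ℝ) : ℝ := gaussianPDFReal 0 1 x

/-- The standard normal distribution function. -/
noncomputable abbrev normalCDF (x : ℝ) : ℝ := cdf (gaussianReal 0 1) x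

theorem normalPDF_eq (x : ℝ) :
    normalPDF x = (√(2 * Real.pi))⁻¹ * Real.exp (-x ^ 2 / 2) := by
  simp [normalPDF, gaussianPDFReal_def]

theorem normalPDF_pos (x : ℝ) : 0 < normalPDF x := gaussianPDFReal_pos 0 1 x one_ne_zero

theorem normalPDF_le_one (x : ℝ) : normalPDF x ≤ 1 := by
  rw [normalPDF_eq]
  have h1 : (1 : ℝ) ≤ √(2 * Real.pi) := by
    rw [Real.one_le_sqrt]; nlinarith [Real.pi_gt_three]
  have h2 : Real.exp (-x ^ 2 / 2) ≤ 1 := by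
    rw [Real.exp_le_one_iff]; nlinarith [sq_nonneg x]
  exact mul_le_one₀ (inv_le_one_of_one_le₀ h1) (Real.exp_pos _).le h2

theorem normalPDF_neg (x : ℝ) : normalPDF (-x) = normalPDF x := by
  simp [normalPDF_eq]

theorem hasDerivAt_normalPDF (x : ℝ) : HasDerivAt normalPDF (-(x * normalPDF x)) x := by
  have h : HasDerivAt (fun x : ℝ => (√(2 * Real.pi))⁻¹ * Real.exp (-x ^ 2 / 2))
      ((√(2 * Real.pi))⁻¹ * (Real.exp (-x ^ 2 / 2) * (-(2 * x) / 2))) x := by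
    have := (((hasDerivAt_pow 2 x).neg.div_const 2).exp).const_mul (√(2 * Real.pi))⁻¹
    simpa using this
  rw [show normalPDF = fun x : ℝ => (√(2 * Real.pi))⁻¹ * Real.exp (-x ^ 2 / 2) from
    funext normalPDF_eq]
  convert h using 1
  ring

theorem continuous_normalPDF : Continuous normalPDF :=
  continuous_iff_continuousAt.2 fun x => (hasDerivAt_normalPDF x).continuousAt

theorem integrable_normalPDF : Integrable normalPDF := integrable_gaussianPDFReal 0 1

theorem normalCDF_eq_integral (x : ℝ) : normalCDF x = ∫ t in Set.Iic x, normalPDF t := by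
  rw [normalCDF, cdf_eq_real, measureReal_def, gaussianReal_apply_eq_integral _ one_ne_zero,
    ENNReal.toReal_ofReal]
  exact setIntegral_nonneg measurableSet_Iic fun t _ => (normalPDF_pos t).le

theorem one_sub_normalCDF_eq_integral (x : ℝ) :
    1 - normalCDF x = ∫ t in Set.Ioi x, normalPDF t := by
  have h := intervalIntegral.integral_Iic_add_Ioi (b := x) (μ := volume)
    integrable_normalPDF.integrableOn integrable_normalPDF.integrableOn
  rw [← normalCDF_eq_integral, integral_gaussianPDFReal_eq_one 0 one_ne_zero] at h
  linarith

theorem normalCDF_sub (a b : ℝ) : normalCDF b - normalCDF a = ∫ t in a..b, normalPDF t := by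
  rw [normalCDF_eq_integral, normalCDF_eq_integral]
  exact intervalIntegral.integral_Iic_sub_Iic integrable_normalPDF.integrableOn
    integrable_normalPDF.integrableOn

theorem hasDerivAt_normalCDF (x : ℝ) : HasDerivAt normalCDF (normalPDF x) x := by
  have h : HasDerivAt (fun u => ∫ t in (0 : ℝ)..u, normalPDF t) (normalPDF x) x :=
    intervalIntegral.integral_hasDerivAt_right (continuous_normalPDF.intervalIntegrable _ _)
      (continuous_normalPDF.stronglyMeasurableAtFilter _ _) continuous_normalPDF.continuousAt
  rw [show normalCDF = fun u => (∫ t in (0 : ℝ)..u, normalPDF t) + normalCDF 0 from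
    funext fun u => by rw [← normalCDF_sub]; ring]
  exact h.add_const _

theorem continuous_normalCDF : Continuous normalCDF :=
  continuous_iff_continuousAt.2 fun x => (hasDerivAt_normalCDF x).continuousAt

theorem normalCDF_nonneg (x : ℝ) : 0 ≤ normalCDF x := cdf_nonneg _ x

theorem normalCDF_le_one (x : ℝ) : normalCDF x ≤ 1 := cdf_le_one _ x

theorem normalCDF_mono {a b : ℝ} (h : a ≤ b) : normalCDF a ≤ normalCDF b := monotone_cdf _ h

/-- The density is at most 1. This is the price of moving a threshold by `d`. -/
theorem normalCDF_add_le (x : ℝ) {d : ℝ} (hd : 0 ≤ d) :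
    normalCDF (x + d) ≤ normalCDF x + d := by
  have h : ∫ t in x..(x + d), normalPDF t ≤ ∫ _ in x..(x + d), (1 : ℝ) :=
    intervalIntegral.integral_mono_on (by linarith)
      (continuous_normalPDF.intervalIntegrable _ _) (by simp) fun t _ => normalPDF_le_one t
  rw [← normalCDF_sub] at h
  simp at h
  linarith

theorem normalCDF_neg (x : ℝ) : normalCDF (-x) = 1 - normalCDF x := by
  rw [one_sub_normalCDF_eq_integral, normalCDF_eq_integral,
    ← integral_comp_neg_Ioi x normalPDF]
  simp only [normalPDF_neg]

/-- Mills' inequality. -/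
theorem mul_one_sub_normalCDF_le {x : ℝ} (hx : 0 ≤ x) :
    x * (1 - normalCDF x) ≤ normalPDF x := by
  have hd : ∀ t ∈ Set.Ici x, HasDerivAt (fun t => -normalPDF t) (t * normalPDF t) t := fun t _ => by
    exact (hasDerivAt_normalPDF t).neg.congr_deriv (neg_neg _)
  have hpos : ∀ t ∈ Set.Ioi x, 0 ≤ t * normalPDF t := fun t ht =>
    mul_nonneg (hx.trans (le_of_lt ht)) (normalPDF_pos t).le
  have hlim : Filter.Tendsto (fun t => -normalPDF t) Filter.atTop (nhds 0) := by
    rw [← neg_zero, ← mul_zero (√(2 * Real.pi))⁻¹]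
    simp only [normalPDF_eq]
    refine (Filter.Tendsto.const_mul _ ?_).neg
    refine Real.tendsto_exp_atBot.comp ?_
    have h2 : Filter.Tendsto (fun t : ℝ => t ^ 2 / 2) Filter.atTop Filter.atTop :=
      (Filter.tendsto_pow_atTop two_ne_zero).atTop_div_const two_pos
    refine (Filter.tendsto_neg_atTop_atBot.comp h2).congr fun t => ?_
    simp [neg_div]
  have hint := integral_Ioi_of_hasDerivAt_of_nonneg' hd hpos hlim
  have hio := integrableOn_Ioi_deriv_of_nonneg' hd hpos hlim
  rw [one_sub_normalCDF_eq_integral, ← integral_const_mul]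
  calc ∫ t in Set.Ioi x, x * normalPDF t ≤ ∫ t in Set.Ioi x, t * normalPDF t :=
        setIntegral_mono_on (integrable_normalPDF.const_mul x).integrableOn hio measurableSet_Ioi
          fun t ht => mul_le_mul_of_nonneg_right (le_of_lt ht) (normalPDF_pos t).le
    _ = normalPDF x := by rw [hint]; ring

theorem abs_mul_min_normalCDF_le (x : ℝ) :
    |x| * min (normalCDF x) (1 - normalCDF x) ≤ normalPDF x := by
  rcases le_total 0 x with hx | hx
  · rw [abs_of_nonneg hx]
    exact (mul_le_mul_of_nonneg_left (min_le_right _ _) hx).trans (mul_one_sub_normalCDF_le hx)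
  · rw [abs_of_nonpos hx]
    refine (mul_le_mul_of_nonneg_left (min_le_left _ _) (neg_nonneg.2 hx)).trans ?_
    have h := mul_one_sub_normalCDF_le (neg_nonneg.2 hx)
    rw [normalCDF_neg, normalPDF_neg] at h
    linarith

/-- Outside `[-1, 1]` Mills' inequality suffices; inside, the density is at least its value at 1.
This is the source of the constant `(normalPDF 1)⁻¹`. -/
theorem min_normalCDF_le (x : ℝ) :
    min (normalCDF x) (1 - normalCDF x) ≤ (normalPDF 1)⁻¹ * normalPDF x := by
  have h0 : 0 ≤ min (normalCDF x) (1 - normalCDF x) :=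
    le_min (normalCDF_nonneg x) (sub_nonneg.2 (normalCDF_le_one x))
  rcases le_total 1 |x| with hx | hx
  · calc min (normalCDF x) (1 - normalCDF x)
        ≤ |x| * min (normalCDF x) (1 - normalCDF x) := le_mul_of_one_le_left h0 hx
      _ ≤ normalPDF x := abs_mul_min_normalCDF_le x
      _ ≤ _ := le_mul_of_one_le_left (normalPDF_pos x).le
          ((one_le_inv₀ (normalPDF_pos 1)).2 (normalPDF_le_one 1))
  · calc min (normalCDF x) (1 - normalCDF x) ≤ 1 :=
          (min_le_left _ _).trans (normalCDF_le_one x)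
      _ = (normalPDF 1)⁻¹ * normalPDF 1 := (inv_mul_cancel₀ (normalPDF_pos 1).ne').symm
      _ ≤ _ := by
        refine mul_le_mul_of_nonneg_left ?_ (inv_nonneg.2 (normalPDF_pos 1).le)
        rw [normalPDF_eq, normalPDF_eq]
        have : x ^ 2 ≤ 1 := by rwa [sq_le_one_iff_abs_le_one]
        refine mul_le_mul_of_nonneg_left (Real.exp_le_exp.2 ?_) (by positivity)
        linarith

/-! ### Stein's equation for a half-line -/

/-- The bounded solution of the Stein equation `f' w = w * f w + 1{w ≤ z} - Φ z`. -/
noncomputable def steinSol (z w : ℝ) : ℝ :=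
  normalCDF (min w z) * (1 - normalCDF (max w z)) / normalPDF w

theorem continuous_steinSol (z : ℝ) : Continuous (steinSol z) := by
  unfold steinSol
  refine Continuous.div ?_ continuous_normalPDF fun w => (normalPDF_pos w).ne'
  exact (continuous_normalCDF.comp (continuous_id.min continuous_const)).mul
    (continuous_const.sub (continuous_normalCDF.comp (continuous_id.max continuous_const)))

theorem steinSol_nonneg (z w : ℝ) : 0 ≤ steinSol z w :=
  div_nonneg (mul_nonneg (normalCDF_nonneg _) (sub_nonneg.2 (normalCDF_le_one _)))
    (normalPDF_pos w).le

/-- Dropping either factor of the numerator and using monotonicity of `Φ` removes `z`, so the bounds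
on the solution are uniform in the threshold. -/
theorem steinSol_mul_normalPDF_le (z w : ℝ) :
    steinSol z w * normalPDF w ≤ min (normalCDF w) (1 - normalCDF w) := by
  rw [steinSol, div_mul_cancel₀ _ (normalPDF_pos w).ne']
  refine le_min ?_ ?_
  · calc normalCDF (min w z) * (1 - normalCDF (max w z)) ≤ normalCDF w * 1 :=
          mul_le_mul (normalCDF_mono (min_le_left _ _)) (by linarith [normalCDF_nonneg (max w z)])
            (sub_nonneg.2 (normalCDF_le_one _)) (normalCDF_nonneg _)
      _ = normalCDF w := mul_one _
  · calc normalCDF (min w z) * (1 - normalCDF (max w z)) ≤ 1 * (1 - normalCDF w) :=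
          mul_le_mul (normalCDF_le_one _) (by linarith [normalCDF_mono (le_max_left w z)])
            (sub_nonneg.2 (normalCDF_le_one _)) zero_le_one
      _ = _ := one_mul _

theorem steinSol_le (z w : ℝ) : steinSol z w ≤ (normalPDF 1)⁻¹ :=
  le_of_mul_le_mul_right ((steinSol_mul_normalPDF_le z w).trans (min_normalCDF_le w))
    (normalPDF_pos w)

theorem abs_mul_steinSol_le (z w : ℝ) : |w| * steinSol z w ≤ 1 := by
  refine le_of_mul_le_mul_right ?_ (normalPDF_pos w)
  rw [one_mul, mul_assoc]
  exact (mul_le_mul_of_nonneg_left (steinSol_mul_normalPDF_le z w) (abs_nonneg w)).trans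
    (abs_mul_min_normalCDF_le w)

/-- The right-hand side of the Stein equation. -/
noncomputable def steinDeriv (z w : ℝ) : ℝ :=
  w * steinSol z w + Set.indicator (Set.Iic z) 1 w - normalCDF z

theorem abs_steinDeriv_le (z w : ℝ) : |steinDeriv z w| ≤ 2 := by
  have h1 : |w * steinSol z w| ≤ 1 := by
    rw [abs_mul, abs_of_nonneg (steinSol_nonneg z w)]; exact abs_mul_steinSol_le z w
  have h2 := normalCDF_nonneg z
  have h3 := normalCDF_le_one z
  rw [abs_le] at h1 ⊢
  unfold steinDeriv
  by_cases hw : w ∈ Set.Iic z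
  · rw [Set.indicator_of_mem hw]
    simp only [Pi.one_apply]
    constructor <;> linarith
  · rw [Set.indicator_of_notMem hw]
    constructor <;> linarith

theorem hasDerivAt_steinSol {z w : ℝ} (hw : w ≠ z) :
    HasDerivAt (steinSol z) (steinDeriv z w) w := by
  have hp := (normalPDF_pos w).ne'
  rcases hw.lt_or_gt with h | h
  · have hd := (((hasDerivAt_normalCDF w).mul_const (1 - normalCDF z)).div
      (hasDerivAt_normalPDF w) hp)
    refine (hd.congr_of_eventuallyEq (f₁ := steinSol z) ?_).congr_deriv ?_
    · filter_upwards [Iio_mem_nhds h] with u (hu : u < z)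
      simp [steinSol, min_eq_left (le_of_lt hu), max_eq_right (le_of_lt hu)]
    · rw [steinDeriv, Set.indicator_of_mem (show w ∈ Set.Iic z from h.le), steinSol,
        min_eq_left h.le, max_eq_right h.le, Pi.one_apply]
      field_simp
      ring
  · have hd := (((hasDerivAt_normalCDF w).const_sub 1).const_mul (normalCDF z)).div
      (hasDerivAt_normalPDF w) hp
    refine (hd.congr_of_eventuallyEq (f₁ := steinSol z) ?_).congr_deriv ?_
    · filter_upwards [Ioi_mem_nhds h] with u (hu : z < u)
      simp [steinSol, min_eq_right (le_of_lt hu), max_eq_left (le_of_lt hu)]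
    · rw [steinDeriv, Set.indicator_of_notMem (show w ∉ Set.Iic z from not_le.2 h), steinSol,
        min_eq_right h.le, max_eq_left h.le]
      field_simp
      ring

theorem intervalIntegrable_steinDeriv (z a b : ℝ) :
    IntervalIntegrable (steinDeriv z) volume a b := by
  unfold steinDeriv
  refine ((Continuous.intervalIntegrable (by have := continuous_steinSol z; fun_prop) _ _).add
    ?_).sub intervalIntegrable_const
  rw [intervalIntegrable_iff]
  exact (integrableOn_const (by simp)).indicator measurableSet_Iic

/-- The solution is continuous with a kink only at `z`, and one exceptional point does not affect
the fundamental theorem of calculus. -/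
theorem integral_steinDeriv (z a b : ℝ) :
    ∫ w in a..b, steinDeriv z w = steinSol z b - steinSol z a :=
  integral_eq_of_hasDerivAt_off_countable _ _ (Set.countable_singleton z)
    (continuous_steinSol z).continuousOn
    (fun w hw => hasDerivAt_steinSol (by simpa using hw.2))
    (intervalIntegrable_steinDeriv z a b)

theorem abs_steinSol_sub_le (z a b : ℝ) : |steinSol z b - steinSol z a| ≤ 2 * |b - a| := by
  rw [← integral_steinDeriv]
  exact intervalIntegral.norm_integral_le_of_norm_le_const (f := steinDeriv z)
    fun w _ => abs_steinDeriv_le z w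

theorem abs_mul_steinSol_sub_le (z w v : ℝ) :
    |v * steinSol z v - w * steinSol z w| ≤ ((normalPDF 1)⁻¹ + 2 * |w|) * |v - w| := by
  have h1 : v * steinSol z v - w * steinSol z w
      = (v - w) * steinSol z v + w * (steinSol z v - steinSol z w) := by ring
  rw [h1]
  refine (abs_add_le _ _).trans ?_
  rw [abs_mul, abs_mul, abs_of_nonneg (steinSol_nonneg z v)]
  nlinarith [mul_le_mul_of_nonneg_left (steinSol_le z v) (abs_nonneg (v - w)),
    mul_le_mul_of_nonneg_left (abs_steinSol_sub_le z w v) (abs_nonneg w)]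

/-- The increment is the integral of `steinDeriv` over points `v` within `d` of `w`. Replacing `v`
by `w` costs a Lipschitz error in the smooth term, while `w ≤ z - d` forces `v ≤ z`, so the shifted
indicator at `w` lies below the one at `v`. -/
theorem le_steinSol_sub (z : ℝ) {a d w : ℝ} (hd : 0 ≤ d) (hw : w ∈ Set.Icc a (a + d)) :
    d * (w * steinSol z w - d * ((normalPDF 1)⁻¹ + 2 * |w|)
      + Set.indicator (Set.Iic (z - d)) 1 w - normalCDF z)
      ≤ steinSol z (a + d) - steinSol z a := by
  rw [← integral_steinDeriv]
  have hC : 0 ≤ (normalPDF 1)⁻¹ + 2 * |w| :=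
    add_nonneg (inv_nonneg.2 (normalPDF_pos 1).le) (by positivity)
  have h := intervalIntegral.integral_mono_on (a := a) (b := a + d)
    (f := fun _ => w * steinSol z w - d * ((normalPDF 1)⁻¹ + 2 * |w|)
      + Set.indicator (Set.Iic (z - d)) 1 w - normalCDF z) (g := steinDeriv z) (μ := volume)
    (by linarith) intervalIntegrable_const (intervalIntegrable_steinDeriv z _ _) fun v hv => ?_
  · rwa [intervalIntegral.integral_const, add_sub_cancel_left, smul_eq_mul] at h
  · have h1 := (abs_mul_steinSol_sub_le z w v)
    have h2 : |v - w| ≤ d := by rw [abs_le]; constructor <;> linarith [hv.1, hv.2, hw.1, hw.2]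
    have h3 := (abs_le.1 (h1.trans (mul_le_mul_of_nonneg_left h2 hC))).1
    have h4 : Set.indicator (Set.Iic (z - d)) (1 : ℝ → ℝ) w ≤ Set.indicator (Set.Iic z) 1 v := by
      by_cases hwz : w ∈ Set.Iic (z - d)
      · have : v ∈ Set.Iic z := by
          simp only [Set.mem_Iic] at hwz ⊢; linarith [(abs_le.1 h2).2]
        rw [Set.indicator_of_mem hwz, Set.indicator_of_mem this]; simp
      · rw [Set.indicator_of_notMem hwz]
        exact Set.indicator_nonneg (fun _ _ => zero_le_one) _
    unfold steinDeriv
    linarith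

theorem steinSol_sub_le (z : ℝ) {a d w : ℝ} (hd : 0 ≤ d) (hw : w ∈ Set.Icc a (a + d)) :
    steinSol z (a + d) - steinSol z a
      ≤ d * (w * steinSol z w + d * ((normalPDF 1)⁻¹ + 2 * |w|)
        + Set.indicator (Set.Iic (z + d)) 1 w - normalCDF z) := by
  rw [← integral_steinDeriv]
  have hC : 0 ≤ (normalPDF 1)⁻¹ + 2 * |w| :=
    add_nonneg (inv_nonneg.2 (normalPDF_pos 1).le) (by positivity)
  have h := intervalIntegral.integral_mono_on (a := a) (b := a + d)
    (g := fun _ => w * steinSol z w + d * ((normalPDF 1)⁻¹ + 2 * |w|)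
      + Set.indicator (Set.Iic (z + d)) 1 w - normalCDF z) (f := steinDeriv z) (μ := volume)
    (by linarith) (intervalIntegrable_steinDeriv z _ _) intervalIntegrable_const fun v hv => ?_
  · rwa [intervalIntegral.integral_const, add_sub_cancel_left, smul_eq_mul] at h
  · have h1 := (abs_mul_steinSol_sub_le z w v)
    have h2 : |v - w| ≤ d := by rw [abs_le]; constructor <;> linarith [hv.1, hv.2, hw.1, hw.2]
    have h3 := (abs_le.1 (h1.trans (mul_le_mul_of_nonneg_left h2 hC))).2
    have h4 : Set.indicator (Set.Iic z) (1 : ℝ → ℝ) v ≤ Set.indicator (Set.Iic (z + d)) 1 w := by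
      by_cases hvz : v ∈ Set.Iic z
      · have : w ∈ Set.Iic (z + d) := by
          simp only [Set.mem_Iic] at hvz ⊢; linarith [(abs_le.1 h2).1]
        rw [Set.indicator_of_mem hvz, Set.indicator_of_mem this]; simp
      · rw [Set.indicator_of_notMem hvz]
        exact Set.indicator_nonneg (fun _ _ => zero_le_one) _
    unfold steinDeriv
    linarith

/-! ### Independent Bernoulli variables and discrete integration by parts -/

/-- The expectation of `G` under the product of the Bernoulli laws with parameters `p e`. -/
noncomputable def bernExp {ι : Type*} [Fintype ι] [DecidableEq ι] (p : ι → ℝ) (G : (ι → Bool) → ℝ) : ℝ :=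
  ∑ c : ι → Bool, (∏ e, if c e then p e else 1 - p e) * G c

/-- The centred Bernoulli variable at the coordinate `k`. -/
noncomputable def bernCentered {ι : Type*} (p : ι → ℝ) (k : ι) (c : ι → Bool) : ℝ :=
  (if c k then 1 else 0) - p k

theorem sum_bernCentered_update {ι : Type*} [DecidableEq ι] {p : ι → ℝ} {S : Finset ι} {k : ι} (hk : k ∈ S) (c : ι → Bool) (b : Bool) :
    ∑ l ∈ S, bernCentered p l (Function.update c k b)
      = (if b then 1 else 0) - p k + ∑ l ∈ S.erase k, bernCentered p l c := by
  rw [← Finset.add_sum_erase _ _ hk]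
  congr 1
  · simp [bernCentered]
  · refine Finset.sum_congr rfl fun l hl => ?_
    rw [bernCentered, Function.update_of_ne (Finset.ne_of_mem_erase hl), bernCentered]

/-- The endpoints are the values of the normalized sum with coordinate `k` switched off and on, so
the actual value is one of them. -/
theorem sum_bernCentered_div_mem_Icc {ι : Type*} [DecidableEq ι] {p : ι → ℝ} {S : Finset ι}
    {s : ℝ} (hs : 0 < s) {k : ι} (hk : k ∈ S) (c : ι → Bool) :
    (∑ l ∈ S, bernCentered p l c) / s ∈
      Set.Icc ((-p k + ∑ l ∈ S.erase k, bernCentered p l c) / s)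
        ((-p k + ∑ l ∈ S.erase k, bernCentered p l c) / s + s⁻¹) := by
  have h : ∑ l ∈ S, bernCentered p l c
      = (if c k then 1 else 0) - p k + ∑ l ∈ S.erase k, bernCentered p l c := by
    rw [← Finset.add_sum_erase _ _ hk, bernCentered]
  rw [h, ← one_div, ← add_div]
  have h0 : (0 : ℝ) ≤ (if c k then 1 else 0) := by split_ifs <;> norm_num
  have h1 : (if c k then 1 else 0) ≤ (1 : ℝ) := by split_ifs <;> norm_num
  constructor <;> refine div_le_div_of_nonneg_right ?_ hs.le <;> linarith

section BernExp

variable {ι : Type*} [Fintype ι] [DecidableEq ι] {p : ι → ℝ}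

theorem bernExp_add (G H : (ι → Bool) → ℝ) :
    bernExp p (fun c => G c + H c) = bernExp p G + bernExp p H := by
  simp [bernExp, mul_add, Finset.sum_add_distrib]

theorem bernExp_sub (G H : (ι → Bool) → ℝ) :
    bernExp p (fun c => G c - H c) = bernExp p G - bernExp p H := by
  simp [bernExp, mul_sub, Finset.sum_sub_distrib]

theorem bernExp_const_mul (a : ℝ) (G : (ι → Bool) → ℝ) :
    bernExp p (fun c => a * G c) = a * bernExp p G := by
  simp only [bernExp, Finset.mul_sum]
  exact Finset.sum_congr rfl fun c _ => by ring

theorem bernExp_sum {κ : Type*} (S : Finset κ) (G : κ → (ι → Bool) → ℝ) :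
    bernExp p (fun c => ∑ k ∈ S, G k c) = ∑ k ∈ S, bernExp p (G k) := by
  simp only [bernExp, Finset.mul_sum]
  exact Finset.sum_comm

theorem bernExp_mono (hp : ∀ e, p e ∈ Set.Icc (0 : ℝ) 1) {G H : (ι → Bool) → ℝ}
    (h : ∀ c, G c ≤ H c) : bernExp p G ≤ bernExp p H := by
  refine Finset.sum_le_sum fun c _ => mul_le_mul_of_nonneg_left (h c) ?_
  refine Finset.prod_nonneg fun e _ => ?_
  split_ifs
  · exact (hp e).1
  · exact sub_nonneg.2 (hp e).2

/-- Flipping coordinate `k` is an involution, so pairing each configuration with its flip counts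
every configuration twice. -/
theorem sum_bool_fun_eq (k : ι) (F : (ι → Bool) → ℝ) :
    2 * ∑ c, F c = ∑ c, (F (Function.update c k true) + F (Function.update c k false)) := by
  have hinv : Function.Involutive fun c : ι → Bool => Function.update c k (!c k) := fun c => by
    simp
  have h : ∑ c, F (Function.update c k (!c k)) = ∑ c, F c := hinv.toPerm.sum_comp _ F (by simp)
  rw [two_mul]
  nth_rw 2 [← h]
  rw [← Finset.sum_add_distrib]
  refine Finset.sum_congr rfl fun c _ => ?_
  have hc := Function.update_eq_self k c
  cases hk : c k <;> rw [hk] at hc <;> simp only [Bool.not_true, Bool.not_false, hc]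
  exact add_comm _ _

/-- Averaging over one coordinate. -/
theorem bernExp_update (k : ι) (G : (ι → Bool) → ℝ) :
    bernExp p G = bernExp p fun c =>
      p k * G (Function.update c k true) + (1 - p k) * G (Function.update c k false) := by
  have hw : ∀ (c : ι → Bool) (b : Bool),
      (∏ e, if Function.update c k b e then p e else 1 - p e)
        = (if b then p k else 1 - p k) * ∏ e ∈ Finset.univ.erase k, if c e then p e else 1 - p e := by
    intro c b
    rw [← Finset.mul_prod_erase _ _ (Finset.mem_univ k), Function.update_self]
    congr 1
    refine Finset.prod_congr rfl fun e he => ?_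
    rw [Function.update_of_ne (Finset.ne_of_mem_erase he)]
  refine mul_left_cancel₀ (two_ne_zero' ℝ) ?_
  rw [bernExp, bernExp, sum_bool_fun_eq k, sum_bool_fun_eq k]
  refine Finset.sum_congr rfl fun c _ => ?_
  simp only [hw, Function.update_idem, if_true, Bool.false_eq_true, if_false]
  ring

/-- Integration by parts in one coordinate: the centred variable is `1 - p k` with probability `p k`
and `-p k` with probability `1 - p k`, so the two values of `F` enter with opposite weights `± p k
(1 - p k)`. -/
theorem bernExp_mul_bernCentered (k : ι) {G : (ι → Bool) → ℝ}
    (hG : ∀ c b, G (Function.update c k b) = G c) (F : (ι → Bool) → ℝ) :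
    bernExp p (fun c => G c * (bernCentered p k c * F c))
      = p k * (1 - p k) * bernExp p fun c =>
          G c * (F (Function.update c k true) - F (Function.update c k false)) := by
  rw [bernExp_update k, ← bernExp_const_mul]
  congr 1
  funext c
  simp only [hG, bernCentered, Function.update_self, if_true, Bool.false_eq_true, if_false]
  ring

variable {S : Finset ι} {G : (ι → Bool) → ℝ}

theorem bernExp_mul_sum_bernCentered (hG : ∀ k ∈ S, ∀ c b, G (Function.update c k b) = G c)
    (F : (ι → Bool) → ℝ) :
    bernExp p (fun c => G c * ((∑ k ∈ S, bernCentered p k c) * F c))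
      = ∑ k ∈ S, p k * (1 - p k) * bernExp p fun c =>
          G c * (F (Function.update c k true) - F (Function.update c k false)) := by
  simp only [Finset.sum_mul, Finset.mul_sum]
  rw [bernExp_sum]
  exact Finset.sum_congr rfl fun k hk => bernExp_mul_bernCentered k (hG k hk) F

theorem bernExp_mul_sum_bernCentered_eq_zero
    (hG : ∀ k ∈ S, ∀ c b, G (Function.update c k b) = G c) :
    bernExp p (fun c => G c * ∑ k ∈ S, bernCentered p k c) = 0 := by
  have h := bernExp_mul_sum_bernCentered (p := p) hG fun _ => 1
  simp only [mul_one, sub_self, mul_zero] at h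
  rw [h]
  exact Finset.sum_eq_zero fun k _ => by simp [bernExp]

/-- Integration by parts with `F` the sum itself, whose increment in each coordinate of `S` is
exactly 1. -/
theorem bernExp_mul_sum_bernCentered_sq
    (hG : ∀ k ∈ S, ∀ c b, G (Function.update c k b) = G c) :
    bernExp p (fun c => G c * (∑ k ∈ S, bernCentered p k c) ^ 2)
      = (∑ k ∈ S, p k * (1 - p k)) * bernExp p G := by
  simp only [sq]
  rw [bernExp_mul_sum_bernCentered hG, Finset.sum_mul]
  refine Finset.sum_congr rfl fun k hk => ?_
  simp [sum_bernCentered_update hk]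

variable {s : ℝ}

/-- Apply `|W| ≤ (1 + W²) / 2`; the weighted second moment of `W` equals the expectation of the
weight. -/
theorem bernExp_mul_abs_le (hp : ∀ e, p e ∈ Set.Icc (0 : ℝ) 1) (hG0 : ∀ c, 0 ≤ G c)
    (hG : ∀ k ∈ S, ∀ c b, G (Function.update c k b) = G c) (hs : 0 < s)
    (hs2 : s ^ 2 = ∑ k ∈ S, p k * (1 - p k)) :
    bernExp p (fun c => G c * |(∑ k ∈ S, bernCentered p k c) / s|) ≤ bernExp p G := by
  have h2 := bernExp_mul_sum_bernCentered_sq (p := p) hG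
  have h3 : bernExp p (fun c => 2⁻¹ * (G c + (s ^ 2)⁻¹ * (G c * (∑ k ∈ S, bernCentered p k c) ^ 2)))
      = bernExp p G := by
    rw [bernExp_const_mul, bernExp_add, bernExp_const_mul, h2, ← hs2]
    field_simp
    ring
  refine le_trans (bernExp_mono hp fun c => ?_) h3.le
  have h4 := sq_nonneg (|(∑ k ∈ S, bernCentered p k c) / s| - 1)
  rw [sub_sq, sq_abs, div_pow] at h4
  have h5 := mul_nonneg (hG0 c) h4
  calc _ ≤ G c * |(∑ k ∈ S, bernCentered p k c) / s| + 2⁻¹ * (G c *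
      ((∑ k ∈ S, bernCentered p k c) ^ 2 / s ^ 2 -
        2 * |(∑ k ∈ S, bernCentered p k c) / s| * 1 + 1 ^ 2)) := by linarith
    _ = _ := by rw [div_eq_mul_inv]; ring

theorem bernExp_mul_stein (hG : ∀ k ∈ S, ∀ c b, G (Function.update c k b) = G c) (f : ℝ → ℝ) :
    bernExp p (fun c => G c * ((∑ k ∈ S, bernCentered p k c) / s
        * f ((∑ k ∈ S, bernCentered p k c) / s)))
      = ∑ k ∈ S, p k * (1 - p k) * s⁻¹ * bernExp p fun c => G c *
          (f ((-p k + ∑ l ∈ S.erase k, bernCentered p l c) / s + s⁻¹)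
            - f ((-p k + ∑ l ∈ S.erase k, bernCentered p l c) / s)) := by
  have h := bernExp_mul_sum_bernCentered (p := p) hG
    fun c => s⁻¹ * f ((∑ k ∈ S, bernCentered p k c) / s)
  have h1 : (fun c => G c * ((∑ k ∈ S, bernCentered p k c) / s
        * f ((∑ k ∈ S, bernCentered p k c) / s))) = fun c => G c * ((∑ k ∈ S, bernCentered p k c)
        * (s⁻¹ * f ((∑ k ∈ S, bernCentered p k c) / s))) := by
    funext c; ring
  rw [h1, h]
  refine Finset.sum_congr rfl fun k hk => ?_
  rw [mul_assoc (p k * (1 - p k)), ← bernExp_const_mul s⁻¹]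
  congr 2
  funext c
  rw [sum_bernCentered_update hk, sum_bernCentered_update hk]
  simp only [if_true, Bool.false_eq_true, if_false]
  rw [show (1 - p k + ∑ l ∈ S.erase k, bernCentered p l c) / s
    = (-p k + ∑ l ∈ S.erase k, bernCentered p l c) / s + s⁻¹ by ring, zero_sub]
  ring

/-! ### The weighted Berry–Esseen bound -/

/-- An upper comparison in the weighted Berry–Esseen bound, before shifting the threshold. -/
theorem bernExp_indicator_sub_le (hp : ∀ e, p e ∈ Set.Icc (0 : ℝ) 1) (hG0 : ∀ c, 0 ≤ G c)
    (hG : ∀ k ∈ S, ∀ c b, G (Function.update c k b) = G c) (hs : 0 < s)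
    (hs2 : s ^ 2 = ∑ k ∈ S, p k * (1 - p k)) (z : ℝ) :
    bernExp p (fun c => G c *
        (Set.indicator (Set.Iic (z - s⁻¹)) 1 ((∑ k ∈ S, bernCentered p k c) / s) - normalCDF z))
      ≤ s⁻¹ * ((normalPDF 1)⁻¹ + 2) * bernExp p G := by
  set W : (ι → Bool) → ℝ := fun c => (∑ k ∈ S, bernCentered p k c) / s with hW
  set K : (ι → Bool) → ℝ := fun c => W c * steinSol z (W c)
    - s⁻¹ * ((normalPDF 1)⁻¹ + 2 * |W c|)
    + Set.indicator (Set.Iic (z - s⁻¹)) 1 (W c) - normalCDF z with hK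
  have hpq : ∀ k, 0 ≤ p k * (1 - p k) := fun k => mul_nonneg (hp k).1 (sub_nonneg.2 (hp k).2)
  have h1 : bernExp p (fun c => G c * K c) ≤
      bernExp p (fun c => G c * (W c * steinSol z (W c))) := by
    rw [hW, bernExp_mul_stein hG]
    -- By `hs2` the weights `p k (1 - p k) / s²` sum to 1. As `K` does not depend on `k`, it can be
    -- spread over the coordinates and compared with each increment separately.
    calc bernExp p (fun c => G c * K c)
        = ∑ k ∈ S, p k * (1 - p k) * s⁻¹ * bernExp p fun c => s⁻¹ * (G c * K c) := by
          rw [bernExp_const_mul, ← Finset.sum_mul, ← Finset.sum_mul, ← hs2]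
          field_simp
      _ ≤ _ := by
          refine Finset.sum_le_sum fun k hk => mul_le_mul_of_nonneg_left
            (bernExp_mono hp fun c => ?_) (mul_nonneg (hpq k) (inv_nonneg.2 hs.le))
          rw [mul_left_comm]
          exact mul_le_mul_of_nonneg_left (le_steinSol_sub z (inv_nonneg.2 hs.le)
            (sum_bernCentered_div_mem_Icc hs hk c)) (hG0 c)
  have h2 : (fun c => G c * (Set.indicator (Set.Iic (z - s⁻¹)) 1 (W c) - normalCDF z))
      = fun c => (G c * K c - G c * (W c * steinSol z (W c)))
        + (s⁻¹ * (normalPDF 1)⁻¹ * G c + s⁻¹ * 2 * (G c * |W c|)) := by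
    funext c; rw [hK]; ring
  rw [h2, bernExp_add, bernExp_sub, bernExp_add, bernExp_const_mul, bernExp_const_mul]
  have h3 := mul_le_mul_of_nonneg_left (bernExp_mul_abs_le hp hG0 hG hs hs2)
    (mul_nonneg (inv_nonneg.2 hs.le) zero_le_two)
  linarith

/-- The mirror image of `bernExp_indicator_sub_le`, with `steinSol_sub_le` bounding the increments
from above. -/
theorem le_bernExp_indicator_sub (hp : ∀ e, p e ∈ Set.Icc (0 : ℝ) 1) (hG0 : ∀ c, 0 ≤ G c)
    (hG : ∀ k ∈ S, ∀ c b, G (Function.update c k b) = G c) (hs : 0 < s)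
    (hs2 : s ^ 2 = ∑ k ∈ S, p k * (1 - p k)) (z : ℝ) :
    -(s⁻¹ * ((normalPDF 1)⁻¹ + 2) * bernExp p G) ≤ bernExp p (fun c => G c *
        (Set.indicator (Set.Iic (z + s⁻¹)) 1 ((∑ k ∈ S, bernCentered p k c) / s)
          - normalCDF z)) := by
  set W : (ι → Bool) → ℝ := fun c => (∑ k ∈ S, bernCentered p k c) / s with hW
  set K : (ι → Bool) → ℝ := fun c => W c * steinSol z (W c)
    + s⁻¹ * ((normalPDF 1)⁻¹ + 2 * |W c|)
    + Set.indicator (Set.Iic (z + s⁻¹)) 1 (W c) - normalCDF z with hK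
  have hpq : ∀ k, 0 ≤ p k * (1 - p k) := fun k => mul_nonneg (hp k).1 (sub_nonneg.2 (hp k).2)
  have h1 : bernExp p (fun c => G c * (W c * steinSol z (W c))) ≤
      bernExp p (fun c => G c * K c) := by
    rw [hW, bernExp_mul_stein hG]
    calc _ ≤ ∑ k ∈ S, p k * (1 - p k) * s⁻¹ * bernExp p fun c => s⁻¹ * (G c * K c) := by
          refine Finset.sum_le_sum fun k hk => mul_le_mul_of_nonneg_left
            (bernExp_mono hp fun c => ?_) (mul_nonneg (hpq k) (inv_nonneg.2 hs.le))
          rw [mul_left_comm s⁻¹]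
          exact mul_le_mul_of_nonneg_left (steinSol_sub_le z (inv_nonneg.2 hs.le)
            (sum_bernCentered_div_mem_Icc hs hk c)) (hG0 c)
      _ = bernExp p (fun c => G c * K c) := by
          rw [bernExp_const_mul, ← Finset.sum_mul, ← Finset.sum_mul, ← hs2]
          field_simp
  have h2 : (fun c => G c * (Set.indicator (Set.Iic (z + s⁻¹)) 1 (W c) - normalCDF z))
      = fun c => (G c * K c - G c * (W c * steinSol z (W c)))
        - (s⁻¹ * (normalPDF 1)⁻¹ * G c + s⁻¹ * 2 * (G c * |W c|)) := by
    funext c; rw [hK]; ring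
  rw [h2, bernExp_sub, bernExp_sub, bernExp_add, bernExp_const_mul, bernExp_const_mul]
  have h3 := mul_le_mul_of_nonneg_left (bernExp_mul_abs_le hp hG0 hG hs hs2)
    (mul_nonneg (inv_nonneg.2 hs.le) zero_le_two)
  linarith

/-- The Berry–Esseen bound for sums of independent Bernoulli variables over `S`, weighted by a
nonnegative function that does not depend on the coordinates in `S`. -/
theorem abs_bernExp_indicator_sub_le (hp : ∀ e, p e ∈ Set.Icc (0 : ℝ) 1) (hG0 : ∀ c, 0 ≤ G c)
    (hG : ∀ k ∈ S, ∀ c b, G (Function.update c k b) = G c) (hs : 0 < s)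
    (hs2 : s ^ 2 = ∑ k ∈ S, p k * (1 - p k)) (z : ℝ) :
    |bernExp p (fun c => G c *
        (Set.indicator (Set.Iic z) 1 ((∑ k ∈ S, bernCentered p k c) / s) - normalCDF z))|
      ≤ s⁻¹ * ((normalPDF 1)⁻¹ + 3) * bernExp p G := by
  have hs' : 0 ≤ s⁻¹ := inv_nonneg.2 hs.le
  have hG' : 0 ≤ bernExp p G := by
    have h := bernExp_mono hp hG0
    simpa [bernExp] using h
  have hsplit : ∀ z', bernExp p (fun c => G c *
      (Set.indicator (Set.Iic z) 1 ((∑ k ∈ S, bernCentered p k c) / s) - normalCDF z))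
      = bernExp p (fun c => G c *
      (Set.indicator (Set.Iic z) 1 ((∑ k ∈ S, bernCentered p k c) / s) - normalCDF z'))
        + (normalCDF z' - normalCDF z) * bernExp p G := fun z' => by
    rw [← bernExp_const_mul, ← bernExp_add]
    congr 1; funext c; ring
  rw [abs_le]
  constructor
  -- Solving Stein's equation at a threshold displaced by `s⁻¹` puts the indicator at `z`; returning
  -- `Φ` to `z` costs `s⁻¹` more, which turns the constant 2 into 3.
  · have h := le_bernExp_indicator_sub hp hG0 hG hs hs2 (z - s⁻¹)
    rw [sub_add_cancel] at h
    rw [hsplit (z - s⁻¹)]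
    have h2 := normalCDF_add_le (z - s⁻¹) hs'
    rw [sub_add_cancel] at h2
    nlinarith
  · have h := bernExp_indicator_sub_le hp hG0 hG hs hs2 (z + s⁻¹)
    rw [add_sub_cancel_right] at h
    rw [hsplit (z + s⁻¹)]
    have h2 := normalCDF_add_le z hs'
    nlinarith

end BernExp

/-! ### Measurability of graphons -/

/-- Separate Lipschitz bounds on a rectangle give a joint one, hence continuity there; finitely many
rectangles, Borel because their sides are order-connected, cover the square. -/
theorem IsLipschitzGraphon.measurable_uncurry {f : unitInterval → unitInterval → ℝ} {L : ℝ}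
    (hf : IsLipschitzGraphon f L) : Measurable (Function.uncurry f) := by
  obtain ⟨m, S, T, hord, hcov, -, h1, h2⟩ := hf.piecewiseLipschitz
  have hmeas : ∀ r, MeasurableSet (S r ×ˢ T r) := fun r =>
    (hord r).1.measurableSet.prod (hord r).2.measurableSet
  have hcont : ∀ r, ContinuousOn (Function.uncurry f) (S r ×ˢ T r) := by
    intro r
    refine LipschitzOnWith.continuousOn (K := Real.toNNReal (2 * |L|)) ?_
    refine LipschitzOnWith.of_dist_le_mul fun x hx y hy => ?_
    rw [Real.coe_toNNReal _ (by positivity), Real.dist_eq]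
    have e1 := h1 r x.1 hx.1 y.1 hy.1 x.2 hx.2
    have e2 := h2 r y.1 hy.1 x.2 hx.2 y.2 hy.2
    have d1 : |(x.1 : ℝ) - y.1| ≤ dist x y := (le_max_left (dist x.1 y.1) (dist x.2 y.2))
    have d2 : |(x.2 : ℝ) - y.2| ≤ dist x y := (le_max_right (dist x.1 y.1) (dist x.2 y.2))
    have b1 : L * |(x.1 : ℝ) - y.1| ≤ |L| * dist x y :=
      mul_le_mul (le_abs_self L) d1 (abs_nonneg _) (abs_nonneg _)
    have b2 : L * |(x.2 : ℝ) - y.2| ≤ |L| * dist x y :=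
      mul_le_mul (le_abs_self L) d2 (abs_nonneg _) (abs_nonneg _)
    calc |f x.1 x.2 - f y.1 y.2| ≤ |f x.1 x.2 - f y.1 x.2| + |f y.1 x.2 - f y.1 y.2| :=
          abs_sub_le _ _ _
      _ ≤ 2 * |L| * dist x y := by linarith
  refine measurable_of_isOpen fun t ht => ?_
  have hpre : Function.uncurry f ⁻¹' t = ⋃ r, Function.uncurry f ⁻¹' t ∩ S r ×ˢ T r := by
    rw [← Set.inter_iUnion, hcov, Set.inter_univ]
  rw [hpre]
  refine MeasurableSet.iUnion fun r => ?_
  obtain ⟨u, hu, hut⟩ := continuousOn_iff'.1 (hcont r) t ht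
  rw [hut]
  exact hu.measurableSet.inter (hmeas r)

/-! ### Graphs as edge configurations, and locality of the neighbourhood -/

/-- The possible edges of a graph on `n` vertices. -/
abbrev PossibleEdge (n : ℕ) : Type := {e : Fin n × Fin n // e.1 < e.2}

section Graph

variable {n : ℕ}

/-- The possible edge between two distinct vertices. -/
def edgeBetween (k j : Fin n) (h : k ≠ j) : PossibleEdge n :=
  if hkj : k < j then ⟨(k, j), hkj⟩ else ⟨(j, k), lt_of_le_of_ne (not_lt.1 hkj) h.symm⟩

/-- The adjacency matrix of the graph with a given set of edges. -/
noncomputable def adjOf (c : PossibleEdge n → Bool) : Matrix (Fin n) (Fin n) ℝ := fun k l =>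
  if h : k ≠ l then (if c (edgeBetween k l h) then 1 else 0) else 0

/-- The edge set of the graph with a given adjacency matrix. -/
noncomputable def edgesOf (A : Matrix (Fin n) (Fin n) ℝ) (e : PossibleEdge n) : Bool :=
  decide (A e.1.1 e.1.2 = 1)

/-- The edge parameters determined by a matrix of edge probabilities. -/
def edgeParam (P : Fin n → Fin n → ℝ) (e : PossibleEdge n) : ℝ := P e.1.1 e.1.2

theorem edgeParam_edgeBetween {P : Fin n → Fin n → ℝ} (hP : ∀ k l, P k l = P l k) {k j : Fin n}
    (h : k ≠ j) : edgeParam P (edgeBetween k j h) = P k j := by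
  unfold edgeBetween edgeParam
  split_ifs
  · rfl
  · exact hP j k

theorem adjOf_edgesOf {A : Matrix (Fin n) (Fin n) ℝ} (h01 : ∀ k l, A k l = 0 ∨ A k l = 1)
    (hsymm : ∀ k l, A k l = A l k) (hdiag : ∀ k, A k k = 0) : adjOf (edgesOf A) = A := by
  ext k l
  unfold adjOf
  split_ifs with h1 h2
  · have := of_decide_eq_true h2
    -- Here `A` itself plays the role of the symmetric matrix `P`.
    rw [← edgeParam_edgeBetween hsymm h1]; exact this.symm
  · have : ¬ edgeParam A (edgeBetween k l h1) = 1 := of_decide_eq_false (Bool.eq_false_of_not_eq_true h2)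
    rw [edgeParam_edgeBetween hsymm] at this
    exact ((h01 k l).resolve_right this).symm
  · rw [not_not.1 h1, hdiag]

theorem edgeBetween_injective (j : Fin n) :
    Function.Injective fun v : {v : Fin n // v ≠ j} => edgeBetween v.1 j v.2 := by
  rintro ⟨u, hu⟩ ⟨v, hv⟩ h
  simp only [edgeBetween] at h
  split_ifs at h <;> simp only [Subtype.mk.injEq, Prod.mk.injEq] at h ⊢ <;> grind

/-- The edges joining `j` to a set of other vertices. -/
def edgesAt (j : Fin n) (S : Finset {v : Fin n // v ≠ j}) : Finset (PossibleEdge n) :=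
  S.image fun v => edgeBetween v.1 j v.2

theorem sum_edgesAt (j : Fin n) (S : Finset {v : Fin n // v ≠ j}) (g : PossibleEdge n → ℝ) :
    ∑ e ∈ edgesAt j S, g e = ∑ v ∈ S, g (edgeBetween v.1 j v.2) :=
  Finset.sum_image fun _ _ _ _ h => edgeBetween_injective j h

theorem sum_bernCentered_edgesAt {P : Fin n → Fin n → ℝ} (hP : ∀ k l, P k l = P l k) (j : Fin n)
    (S : Finset {v : Fin n // v ≠ j}) (c : PossibleEdge n → Bool) :
    ∑ e ∈ edgesAt j S, bernCentered (edgeParam P) e c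
      = ∑ v ∈ S, (adjOf c v j - P v j) := by
  rw [sum_edgesAt]
  refine Finset.sum_congr rfl fun v _ => ?_
  rw [bernCentered, edgeParam_edgeBetween hP, adjOf, dif_pos v.2]

/-- An edge at `j` only affects row and column `j`. With `looNeighborhood_congr`, this is the
independence gained by leaving `j` out. -/
theorem adjOf_update_submatrix {j : Fin n} {S : Finset {v : Fin n // v ≠ j}} {e : PossibleEdge n}
    (he : e ∈ edgesAt j S) (c : PossibleEdge n → Bool) (b : Bool) :
    (adjOf (Function.update c e b)).submatrix
        (Subtype.val : {v : Fin n // v ≠ j} → Fin n) (Subtype.val : {v : Fin n // v ≠ j} → Fin n)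
      = (adjOf c).submatrix Subtype.val Subtype.val := by
  obtain ⟨v, -, rfl⟩ := Finset.mem_image.1 he
  ext ⟨k, hk⟩ ⟨l, hl⟩
  simp only [Matrix.submatrix_apply, adjOf]
  by_cases h1 : k = l
  · simp [h1]
  rw [dif_pos h1, dif_pos h1, Function.update_of_ne]
  intro h
  simp only [edgeBetween] at h
  split_ifs at h <;> simp only [Subtype.mk.injEq, Prod.mk.injEq] at h <;> grind

theorem looNeighborhood_congr {h : ℕ} {A B : Matrix (Fin n) (Fin n) ℝ} {j : Fin n}
    (i : {v : Fin n // v ≠ j})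
    (hAB : A.submatrix (Subtype.val : {v : Fin n // v ≠ j} → Fin n)
        (Subtype.val : {v : Fin n // v ≠ j} → Fin n)
      = B.submatrix Subtype.val Subtype.val) :
    looNeighborhood h A j i = looNeighborhood h B j i := by
  unfold looNeighborhood looDist looTwoHop
  rw [hAB]

/-- Removing `i` and `j` leaves `n - 2 ≥ h` candidates, and ties in distance merge no two of them
because each sorting key records its node. -/
theorem card_looNeighborhood {h : ℕ} (hn : h + 2 ≤ n) (A : Matrix (Fin n) (Fin n) ℝ) (j : Fin n)
    (i : {v : Fin n // v ≠ j}) : (looNeighborhood h A j i).card = h := by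
  unfold looNeighborhood
  have hinj : Function.Injective fun k : {v : Fin n // v ≠ j} => toLex (looDist A j i k, k) :=
    fun a b hab => (Prod.mk.inj (toLex.injective hab)).2
  rw [List.toFinset_card_of_nodup, List.length_map, List.length_take, Finset.length_sort,
    Finset.card_image_of_injective _ hinj, Finset.card_erase_of_mem (Finset.mem_univ i)]
  · simp only [Finset.card_univ, Fintype.card_subtype_compl, Fintype.card_fin,
      Fintype.card_unique, ne_eq]
    omega
  · refine List.Nodup.map_on ?_ ((Finset.sort_nodup _ _).sublist (List.take_sublist _ _))
    intro a ha b hb hab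
    have ha' := (Finset.mem_sort _).1 (List.mem_of_mem_take ha)
    have hb' := (Finset.mem_sort _).1 (List.mem_of_mem_take hb)
    obtain ⟨k, -, rfl⟩ := Finset.mem_image.1 ha'
    obtain ⟨l, -, rfl⟩ := Finset.mem_image.1 hb'
    simp only [ofLex_toLex] at hab
    rw [hab]

end Graph

theorem edgeParam_edgeProb_mem_Icc {Ω : Type*} {n : ℕ} {f : unitInterval → unitInterval → ℝ}
    {L : ℝ} {ξ : Fin n → Ω → unitInterval} (hf : IsLipschitzGraphon f L) (ω : Ω) (e : PossibleEdge n) :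
    edgeParam (edgeProb f ξ ω) e ∈ Set.Icc (0 : ℝ) 1 := hf.mem_Icc _ _

/-! ### Conditional expectations in the graphon model -/

/-- The probability of a set of edges under independent Bernoulli edges. -/
noncomputable def edgeWeight {n : ℕ} (c : PossibleEdge n → Bool) (P : Fin n → Fin n → ℝ) : ℝ :=
  ∏ e, if c e then edgeParam P e else 1 - edgeParam P e

theorem measurable_edgeParam {n : ℕ} (e : PossibleEdge n) :
    Measurable fun P : Fin n → Fin n → ℝ => edgeParam P e := by
  unfold edgeParam; fun_prop

theorem measurable_edgeWeight {n : ℕ} (c : PossibleEdge n → Bool) : Measurable (edgeWeight c) := by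
  unfold edgeWeight
  refine Finset.measurable_prod _ fun e _ => ?_
  split_ifs
  · exact measurable_edgeParam e
  · exact (measurable_edgeParam e).const_sub 1

theorem abs_edgeWeight_edgeProb_le {Ω : Type*} {n : ℕ} {f : unitInterval → unitInterval → ℝ}
    {L : ℝ} {ξ : Fin n → Ω → unitInterval} (hf : IsLipschitzGraphon f L) (c : PossibleEdge n → Bool)
    (ω : Ω) : |edgeWeight c (edgeProb f ξ ω)| ≤ 1 := by
  rw [edgeWeight, Finset.abs_prod]
  refine Finset.prod_le_one (fun _ _ => abs_nonneg _) fun e _ => ?_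
  obtain ⟨h0, h1⟩ := edgeParam_edgeProb_mem_Icc (ξ := ξ) hf ω e
  split_ifs <;> rw [abs_le] <;> constructor <;> linarith

section Model

variable {Ω : Type*} [MeasurableSpace Ω] {μ : Measure Ω} {n : ℕ}
  {f : unitInterval → unitInterval → ℝ} {L : ℝ} {ξ : Fin n → Ω → unitInterval}
  {A : Ω → Matrix (Fin n) (Fin n) ℝ}

theorem IsGraphonModel.measurable_edgeProb (hA : IsGraphonModel μ f ξ A)
    (hf : IsLipschitzGraphon f L) : Measurable (edgeProb f ξ) :=
  measurable_pi_iff.2 fun k => measurable_pi_iff.2 fun l =>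
    hf.measurable_uncurry.comp ((hA.measurable_latent k).prodMk (hA.measurable_latent l))

theorem IsGraphonModel.measurable_edgesOf (hA : IsGraphonModel μ f ξ A) :
    Measurable fun ω => edgesOf (A ω) := by
  refine measurable_pi_iff.2 fun e => measurable_to_bool ?_
  have h : (fun ω => edgesOf (A ω) e) ⁻¹' {true} = (fun ω => A ω e.1.1 e.1.2) ⁻¹' {1} := by
    ext ω; simp [edgesOf]
  rw [h]
  exact hA.measurable_adj _ _ (measurableSet_singleton 1)

theorem IsGraphonModel.adjOf_edgesOf (hA : IsGraphonModel μ f ξ A) (ω : Ω) :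
    adjOf (edgesOf (A ω)) = A ω :=
  _root_.adjOf_edgesOf (hA.adj_zero_or_one ω) (hA.adj_symm ω) (hA.adj_diag ω)

theorem IsGraphonModel.condExp_edgesOf (hA : IsGraphonModel μ f ξ A)
    (c : PossibleEdge n → Bool) :
    μ[Set.indicator {ω | edgesOf (A ω) = c} (fun _ => (1 : ℝ)) |
        MeasurableSpace.comap (edgeProb f ξ) inferInstance]
      =ᵐ[μ] fun ω => edgeWeight c (edgeProb f ξ ω) := by
  -- Only entries above the diagonal enter the conditional law, so the default `false` is never
  -- read.
  set a : Fin n → Fin n → Bool := fun k l => if h : k < l then c ⟨(k, l), h⟩ else false with ha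
  have hset : {ω | edgesOf (A ω) = c}
      = {ω | ∀ k l, k < l → A ω k l = if a k l then 1 else 0} := by
    ext ω
    simp only [Set.mem_ofPred_eq, funext_iff, Subtype.forall, Prod.forall]
    refine forall_congr' fun k => forall_congr' fun l => forall_congr' fun h => ?_
    simp only [edgesOf, ha, dif_pos h]
    rcases hA.adj_zero_or_one ω k l with h0 | h0 <;> cases c ⟨(k, l), h⟩ <;> simp [h0]
  rw [hset]
  refine (hA.cond_law a).trans (Filter.EventuallyEq.of_eq (funext fun ω => ?_))
  have h1 : ∀ e : PossibleEdge n, (if c e then edgeParam (edgeProb f ξ ω) e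
      else 1 - edgeParam (edgeProb f ξ ω) e) = (fun e : Fin n × Fin n => if a e.1 e.2
        then edgeProb f ξ ω e.1 e.2 else 1 - edgeProb f ξ ω e.1 e.2) e.1 := by
    rintro ⟨⟨k, l⟩, h⟩
    simp only [ha, edgeParam, dif_pos (show k < l from h)]
  rw [edgeWeight, Finset.prod_congr rfl fun e _ => h1 e,
    ← Finset.prod_subtype (Finset.univ.filter fun e : Fin n × Fin n => e.1 < e.2) (by simp)
      (fun e : Fin n × Fin n => if a e.1 e.2
        then edgeProb f ξ ω e.1 e.2 else 1 - edgeProb f ξ ω e.1 e.2),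
    Finset.prod_filter, Fintype.prod_prod_type]
  refine Finset.prod_congr rfl fun k _ => ?_
  rw [← Finset.prod_filter]
  exact Finset.prod_congr (by ext l; simp) fun _ _ => rfl

variable {h : ℕ} {j : Fin n} {i : {v : Fin n // v ≠ j}}

theorem IsGraphonModel.measurable_looCond (hA : IsGraphonModel μ f ξ A)
    (hf : IsLipschitzGraphon f L) : Measurable (looCond h f ξ A j i) := by
  refine Measurable.prodMk ?_ (hA.measurable_edgeProb hf)
  have h1 : (fun ω => looNeighborhood h (A ω) j i)
      = (fun c => looNeighborhood h (adjOf c) j i) ∘ fun ω => edgesOf (A ω) := by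
    funext ω; simp only [Function.comp, hA.adjOf_edgesOf]
  rw [h1]
  exact (measurable_of_countable _).comp hA.measurable_edgesOf

/-- The edge configuration takes finitely many values, so measurability in `P` for each
configuration gives joint measurability. -/
theorem IsGraphonModel.measurable_of_edges (hA : IsGraphonModel μ f ξ A)
    (hf : IsLipschitzGraphon f L) {Ψ : (PossibleEdge n → Bool) → (Fin n → Fin n → ℝ) → ℝ}
    (hΨ : ∀ c, Measurable (Ψ c)) :
    Measurable fun ω => Ψ (edgesOf (A ω)) (edgeProb f ξ ω) :=
  (measurable_from_prod_countable_right (f := Function.uncurry Ψ) hΨ).comp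
    (hA.measurable_edgesOf.prodMk (hA.measurable_edgeProb hf))

variable [IsProbabilityMeasure μ]

/-- The tower property, pulling the `P`-measurable factor out of the conditional expectation. -/
theorem IsGraphonModel.integral_indicator_mul (hA : IsGraphonModel μ f ξ A)
    (hf : IsLipschitzGraphon f L) (c : PossibleEdge n → Bool) {u : (Fin n → Fin n → ℝ) → ℝ}
    (hu : Measurable u) {C : ℝ} (hC : ∀ ω, |u (edgeProb f ξ ω)| ≤ C) :
    ∫ ω, u (edgeProb f ξ ω) * Set.indicator {ω | edgesOf (A ω) = c} (fun _ => (1 : ℝ)) ω ∂μ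
      = ∫ ω, u (edgeProb f ξ ω) * edgeWeight c (edgeProb f ξ ω) ∂μ := by
  have hm := (hA.measurable_edgeProb hf).comap_le
  have hset : MeasurableSet {ω | edgesOf (A ω) = c} :=
    hA.measurable_edgesOf (measurableSet_singleton c)
  have hi : Integrable (Set.indicator {ω | edgesOf (A ω) = c} (fun _ => (1 : ℝ))) μ :=
    (integrable_const 1).indicator hset
  have hum : StronglyMeasurable[MeasurableSpace.comap (edgeProb f ξ) inferInstance]
      fun ω => u (edgeProb f ξ ω) :=
    (hu.comp (comap_measurable _)).stronglyMeasurable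
  have hprod : Integrable ((fun ω => u (edgeProb f ξ ω)) *
      Set.indicator {ω | edgesOf (A ω) = c} (fun _ => (1 : ℝ))) μ :=
    hi.bdd_mul (hum.mono hm).aestronglyMeasurable (Filter.Eventually.of_forall hC)
  have h := condExp_mul_of_stronglyMeasurable_left hum hprod hi
  calc _ = ∫ ω, (μ[(fun ω => u (edgeProb f ξ ω)) *
        Set.indicator {ω | edgesOf (A ω) = c} (fun _ => (1 : ℝ)) |
        MeasurableSpace.comap (edgeProb f ξ) inferInstance]) ω ∂μ := (integral_condExp hm).symm
    _ = _ := by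
      refine integral_congr_ae ?_
      filter_upwards [h, hA.condExp_edgesOf c] with ω h1 h2
      rw [h1, Pi.mul_apply, h2]

/-- Integrating out the edges given the edge probabilities. -/
theorem IsGraphonModel.integral_eq_integral_bernExp (hA : IsGraphonModel μ f ξ A)
    (hf : IsLipschitzGraphon f L) {Ψ : (PossibleEdge n → Bool) → (Fin n → Fin n → ℝ) → ℝ}
    (hΨ : ∀ c, Measurable (Ψ c)) {C : ℝ} (hC : ∀ c ω, |Ψ c (edgeProb f ξ ω)| ≤ C) :
    ∫ ω, Ψ (edgesOf (A ω)) (edgeProb f ξ ω) ∂μ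
      = ∫ ω, bernExp (edgeParam (edgeProb f ξ ω)) (fun c => Ψ c (edgeProb f ξ ω)) ∂μ := by
  have hP := hA.measurable_edgeProb hf
  have hsum : ∀ ω, Ψ (edgesOf (A ω)) (edgeProb f ξ ω) = ∑ c, Ψ c (edgeProb f ξ ω) *
      Set.indicator {ω | edgesOf (A ω) = c} (fun _ => (1 : ℝ)) ω := by
    intro ω
    rw [Finset.sum_eq_single (edgesOf (A ω))]
    · simp
    · intro c _ hc
      rw [Set.indicator_of_notMem (by simpa using hc.symm), mul_zero]
    · simp
  have hb : ∀ ω, bernExp (edgeParam (edgeProb f ξ ω)) (fun c => Ψ c (edgeProb f ξ ω))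
      = ∑ c, Ψ c (edgeProb f ξ ω) * edgeWeight c (edgeProb f ξ ω) := fun ω =>
    Finset.sum_congr rfl fun c _ => mul_comm _ _
  simp only [hsum, hb]
  rw [integral_finsetSum, integral_finsetSum]
  · exact Finset.sum_congr rfl fun c _ => hA.integral_indicator_mul hf c (hΨ c) (hC c)
  · intro c _
    refine Integrable.of_bound
      (((hΨ c).mul (measurable_edgeWeight c)).comp hP).aestronglyMeasurable (C * 1)
      (Filter.Eventually.of_forall fun ω => ?_)
    rw [norm_mul]
    exact mul_le_mul (hC c ω) (abs_edgeWeight_edgeProb_le hf c ω) (norm_nonneg _)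
      ((abs_nonneg _).trans (hC c ω))
  · intro c _
    refine Integrable.bdd_mul ((integrable_const (1 : ℝ)).indicator
      (hA.measurable_edgesOf (measurableSet_singleton c)))
      ((hΨ c).comp hP).aestronglyMeasurable (Filter.Eventually.of_forall (hC c))

theorem IsGraphonModel.integrable_of_edges (hA : IsGraphonModel μ f ξ A)
    (hf : IsLipschitzGraphon f L) {Ψ : (PossibleEdge n → Bool) → (Fin n → Fin n → ℝ) → ℝ}
    (hΨ : ∀ c, Measurable (Ψ c)) {C : ℝ} (hC : ∀ c ω, |Ψ c (edgeProb f ξ ω)| ≤ C) :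
    Integrable (fun ω => Ψ (edgesOf (A ω)) (edgeProb f ξ ω)) μ :=
  Integrable.of_bound (hA.measurable_of_edges hf hΨ).aestronglyMeasurable C
    (Filter.Eventually.of_forall fun _ => hC _ _)

/-- A sign criterion for conditional expectations given the neighbourhood and the edge
probabilities. -/
theorem IsGraphonModel.condExp_nonneg (hA : IsGraphonModel μ f ξ A)
    (hf : IsLipschitzGraphon f L) {Ψ : (PossibleEdge n → Bool) → (Fin n → Fin n → ℝ) → ℝ}
    (hΨ : ∀ c, Measurable (Ψ c)) {C : ℝ} (hC : ∀ c ω, |Ψ c (edgeProb f ξ ω)| ≤ C)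
    (hpos : ∀ ω (S : Finset {v : Fin n // v ≠ j}), 0 ≤ bernExp (edgeParam (edgeProb f ξ ω))
      fun c => (if looNeighborhood h (adjOf c) j i = S then 1 else 0) * Ψ c (edgeProb f ξ ω)) :
    0 ≤ᵐ[μ] μ[fun ω => Ψ (edgesOf (A ω)) (edgeProb f ξ ω) |
      MeasurableSpace.comap (looCond h f ξ A j i) inferInstance] := by
  have hX : Measurable (looCond h f ξ A j i) := hA.measurable_looCond hf
  have hm := hX.comap_le
  have hint := hA.integrable_of_edges hf hΨ hC
  -- On the trimmed measure, nonnegativity need only be tested by integrals over events of the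
  -- conditioning σ-algebra.
  refine ae_of_ae_trim hm (ae_nonneg_of_forall_setIntegral_nonneg
    (integrable_condExp.trim hm stronglyMeasurable_condExp) ?_)
  rintro s hs -
  rw [← setIntegral_trim hm stronglyMeasurable_condExp hs, setIntegral_condExp hm hint hs]
  obtain ⟨D, hD, rfl⟩ := hs
  rw [← integral_indicator (hX hD)]
  set Ψ' : (PossibleEdge n → Bool) → (Fin n → Fin n → ℝ) → ℝ := fun c P =>
    D.indicator (fun q => Ψ c q.2) (looNeighborhood h (adjOf c) j i, P) with hΨ'
  have h1 : (looCond h f ξ A j i ⁻¹' D).indicator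
      (fun ω => Ψ (edgesOf (A ω)) (edgeProb f ξ ω))
      = fun ω => Ψ' (edgesOf (A ω)) (edgeProb f ξ ω) := by
    funext ω
    simp only [hΨ', hA.adjOf_edgesOf]
    rfl
  have hm' : ∀ c, Measurable (Ψ' c) := fun c =>
    (((hΨ c).comp measurable_snd).indicator hD).comp measurable_prodMk_left
  have hC' : ∀ c ω, |Ψ' c (edgeProb f ξ ω)| ≤ C := by
    intro c ω
    by_cases hmem : (looNeighborhood h (adjOf c) j i, edgeProb f ξ ω) ∈ D
    · simpa [hΨ', hmem] using hC c ω
    · simpa [hΨ', hmem] using (abs_nonneg _).trans (hC c ω)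
  rw [h1, hA.integral_eq_integral_bernExp hf hm' hC']
  refine integral_nonneg fun ω => ?_
  -- Once the value `S` of the neighbourhood and `P` are fixed, membership in `D` is a constant
  -- factor, so `hpos` applies term by term.
  have h2 : (fun c => Ψ' c (edgeProb f ξ ω)) = fun c => ∑ S : Finset {v : Fin n // v ≠ j},
      D.indicator (fun _ => (1 : ℝ)) (S, edgeProb f ξ ω) *
        ((if looNeighborhood h (adjOf c) j i = S then 1 else 0) * Ψ c (edgeProb f ξ ω)) := by
    funext c
    rw [Finset.sum_eq_single (looNeighborhood h (adjOf c) j i)]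
    · by_cases hmem : (looNeighborhood h (adjOf c) j i, edgeProb f ξ ω) ∈ D <;> simp [hΨ', hmem]
    · intro S _ hS
      rw [if_neg hS.symm, zero_mul, mul_zero]
    · simp
  rw [h2, bernExp_sum]
  refine Finset.sum_nonneg fun S _ => ?_
  rw [bernExp_const_mul]
  exact mul_nonneg (Set.indicator_nonneg (fun _ _ => zero_le_one) _) (hpos ω S)

theorem IsGraphonModel.condExp_eq_zero (hA : IsGraphonModel μ f ξ A)
    (hf : IsLipschitzGraphon f L) {Ψ : (PossibleEdge n → Bool) → (Fin n → Fin n → ℝ) → ℝ}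
    (hΨ : ∀ c, Measurable (Ψ c)) {C : ℝ} (hC : ∀ c ω, |Ψ c (edgeProb f ξ ω)| ≤ C)
    (hzero : ∀ ω (S : Finset {v : Fin n // v ≠ j}), bernExp (edgeParam (edgeProb f ξ ω))
      (fun c => (if looNeighborhood h (adjOf c) j i = S then 1 else 0) * Ψ c (edgeProb f ξ ω))
        = 0) :
    μ[fun ω => Ψ (edgesOf (A ω)) (edgeProb f ξ ω) |
      MeasurableSpace.comap (looCond h f ξ A j i) inferInstance] =ᵐ[μ] 0 := by
  have h1 := hA.condExp_nonneg (h := h) (i := i) hf hΨ hC fun ω S => (hzero ω S).ge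
  have h2 := hA.condExp_nonneg (h := h) (i := i) hf (Ψ := fun c P => -1 * Ψ c P)
    (fun c => (hΨ c).const_mul _) (C := C) (fun c ω => by simpa using hC c ω) fun ω S => by
      simp only [mul_left_comm _ (-1 : ℝ)]
      rw [bernExp_const_mul, hzero, mul_zero]
  have h3 := condExp_neg (fun ω => Ψ (edgesOf (A ω)) (edgeProb f ξ ω))
    (MeasurableSpace.comap (looCond h f ξ A j i) inferInstance) (μ := μ)
  simp only [neg_one_mul] at h2
  filter_upwards [h1, h2, h3] with ω e1 e2 e3
  change _ = -_ at e3
  rw [show (fun ω => -Ψ (edgesOf (A ω)) (edgeProb f ξ ω))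
    = -fun ω => Ψ (edgesOf (A ω)) (edgeProb f ξ ω) from rfl, e3] at e2
  simp only [Pi.zero_apply] at e1 e2 ⊢
  linarith

end Model

/-! ### The fluctuation on a fixed neighbourhood -/

section Fluctuation

variable {n : ℕ} {j : Fin n}

/-- The sum of the centred adjacencies to `j` over a set of vertices. -/
noncomputable def fluctSum (A : Matrix (Fin n) (Fin n) ℝ) (P : Fin n → Fin n → ℝ)
    (S : Finset {v : Fin n // v ≠ j}) : ℝ := ∑ k ∈ S, (A k j - P k j)

/-- The sum of the Bernoulli variances of the adjacencies to `j` over a set of vertices. -/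
def varSum (P : Fin n → Fin n → ℝ) (S : Finset {v : Fin n // v ≠ j}) : ℝ :=
  ∑ k ∈ S, P k j * (1 - P k j)

theorem measurable_fluctSum (A : Matrix (Fin n) (Fin n) ℝ) (S : Finset {v : Fin n // v ≠ j}) :
    Measurable fun P => fluctSum A P S := by
  unfold fluctSum; fun_prop

theorem measurable_varSum (S : Finset {v : Fin n // v ≠ j}) :
    Measurable fun P => varSum P S := by
  unfold varSum; fun_prop

theorem abs_fluctSum_le {P : Fin n → Fin n → ℝ} (hP : ∀ k l, P k l ∈ Set.Icc (0 : ℝ) 1)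
    (c : PossibleEdge n → Bool) (S : Finset {v : Fin n // v ≠ j}) :
    |fluctSum (adjOf c) P S| ≤ S.card := by
  refine (Finset.abs_sum_le_sum_abs _ _).trans ?_
  rw [← nsmul_one]
  refine Finset.sum_le_card_nsmul _ _ _ fun k _ => ?_
  obtain ⟨h0, h1⟩ := hP k j
  unfold adjOf
  rw [abs_le]
  split_ifs <;> constructor <;> linarith

theorem abs_varSum_le {P : Fin n → Fin n → ℝ} (hP : ∀ k l, P k l ∈ Set.Icc (0 : ℝ) 1)
    (S : Finset {v : Fin n // v ≠ j}) : |varSum P S| ≤ S.card := by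
  refine (Finset.abs_sum_le_sum_abs _ _).trans ?_
  rw [← nsmul_one]
  refine Finset.sum_le_card_nsmul _ _ _ fun k _ => ?_
  obtain ⟨h0, h1⟩ := hP k j
  rw [abs_le]
  constructor <;> nlinarith

/-- On `[η, 1 - η]` the concave function `p (1 - p)` is smallest at the endpoints. -/
theorem le_varSum {P : Fin n → Fin n → ℝ} {η : ℝ} (hP : ∀ k l, η ≤ P k l ∧ P k l ≤ 1 - η)
    (S : Finset {v : Fin n // v ≠ j}) : S.card * (η * (1 - η)) ≤ varSum P S := by
  rw [← nsmul_eq_mul]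
  refine Finset.card_nsmul_le_sum _ _ _ fun k _ => ?_
  obtain ⟨h0, h1⟩ := hP k j
  nlinarith

variable {h : ℕ} {i : {v : Fin n // v ≠ j}} {P : Fin n → Fin n → ℝ}

/-- The indicator of a neighbourhood does not depend on the edges at the deleted vertex. -/
theorem looNeighborhood_indicator_update (S : Finset {v : Fin n // v ≠ j}) :
    ∀ e ∈ edgesAt j S, ∀ (c : PossibleEdge n → Bool) (b : Bool),
      (if looNeighborhood h (adjOf (Function.update c e b)) j i = S then (1 : ℝ) else 0)
        = if looNeighborhood h (adjOf c) j i = S then 1 else 0 := fun e he c b => by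
  rw [looNeighborhood_congr i (adjOf_update_submatrix he c b)]

/-- Where the indicator is nonzero the random index set is the fixed `S`, so the sum is one of
centred variables that the indicator does not see. The variance identity and the normal
approximation below use the same replacement. -/
theorem bernExp_fluctSum (hP : ∀ k l, P k l = P l k) (S : Finset {v : Fin n // v ≠ j}) :
    bernExp (edgeParam P) (fun c => (if looNeighborhood h (adjOf c) j i = S then 1 else 0) *
      fluctSum (adjOf c) P (looNeighborhood h (adjOf c) j i)) = 0 := by
  refine Eq.trans ?_ (bernExp_mul_sum_bernCentered_eq_zero (p := edgeParam P)
    (G := fun c => if looNeighborhood h (adjOf c) j i = S then (1 : ℝ) else 0)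
    (looNeighborhood_indicator_update (h := h) (i := i) S))
  congr 1
  funext c
  split_ifs with hS
  · rw [sum_bernCentered_edgesAt hP, hS, fluctSum]
  · simp

theorem varSum_eq (hP : ∀ k l, P k l = P l k) (S : Finset {v : Fin n // v ≠ j}) :
    varSum P S = ∑ e ∈ edgesAt j S, edgeParam P e * (1 - edgeParam P e) := by
  rw [sum_edgesAt]
  exact Finset.sum_congr rfl fun v _ => by rw [edgeParam_edgeBetween hP]

theorem bernExp_fluctSum_sq (hP : ∀ k l, P k l = P l k) (S : Finset {v : Fin n // v ≠ j}) :
    bernExp (edgeParam P) (fun c => (if looNeighborhood h (adjOf c) j i = S then 1 else 0) *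
      (fluctSum (adjOf c) P (looNeighborhood h (adjOf c) j i) ^ 2
        - varSum P (looNeighborhood h (adjOf c) j i))) = 0 := by
  have h1 := bernExp_mul_sum_bernCentered_sq (p := edgeParam P)
    (G := fun c => if looNeighborhood h (adjOf c) j i = S then (1 : ℝ) else 0)
    (looNeighborhood_indicator_update (h := h) (i := i) S)
  rw [← varSum_eq hP, ← bernExp_const_mul, ← sub_eq_zero, ← bernExp_sub] at h1
  refine Eq.trans ?_ h1
  congr 1
  funext c
  split_ifs with hS
  · rw [sum_bernCentered_edgesAt hP, hS, fluctSum]; ring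
  · simp

theorem abs_bernExp_fluctSum_indicator_le (hP : ∀ k l, P k l = P l k)
    (hP01 : ∀ k l, P k l ∈ Set.Icc (0 : ℝ) 1) (S : Finset {v : Fin n // v ≠ j})
    (hpos : 0 < varSum P S) (x : ℝ) :
    |bernExp (edgeParam P) (fun c => (if looNeighborhood h (adjOf c) j i = S then 1 else 0) *
      (Set.indicator (Set.Iic x) 1 (fluctSum (adjOf c) P (looNeighborhood h (adjOf c) j i)
        / √(varSum P (looNeighborhood h (adjOf c) j i))) - normalCDF x))|
      ≤ (√(varSum P S))⁻¹ * ((normalPDF 1)⁻¹ + 3) *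
        bernExp (edgeParam P) fun c => if looNeighborhood h (adjOf c) j i = S then 1 else 0 := by
  refine le_trans (le_of_eq ?_) (abs_bernExp_indicator_sub_le (p := edgeParam P)
    (fun e => hP01 _ _) (fun c => by split_ifs <;> norm_num)
    (looNeighborhood_indicator_update (h := h) (i := i) S) (Real.sqrt_pos.2 hpos)
    ((Real.sq_sqrt hpos.le).trans (varSum_eq hP S)) x)
  congr 2
  funext c
  split_ifs with hS
  · rw [sum_bernCentered_edgesAt hP, hS, fluctSum]
  · simp

theorem inv_sqrt_varSum_le {η : ℝ} (hη_pos : 0 < η) (hη_half : η < 1 / 2) (h1 : 1 ≤ h)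
    (hP : ∀ k l, η ≤ P k l ∧ P k l ≤ 1 - η)
    {S : Finset {v : Fin n // v ≠ j}} (hS : S.card = h) :
    0 < varSum P S ∧ (√(varSum P S))⁻¹ ≤ (√(η * (1 - η)))⁻¹ * (h : ℝ) ^ (-(1 / 2) : ℝ) := by
  have hle := le_varSum hP S
  rw [hS] at hle
  have hpos : 0 < η * (1 - η) := mul_pos hη_pos (by linarith)
  have hh : (0 : ℝ) < h := by exact_mod_cast h1
  have hp := mul_pos hh hpos
  refine ⟨hp.trans_le hle, ?_⟩
  rw [Real.rpow_neg hh.le, ← Real.sqrt_eq_rpow, ← mul_inv, ← Real.sqrt_mul hpos.le,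
    mul_comm (η * (1 - η))]
  exact inv_anti₀ (Real.sqrt_pos.2 hp) (Real.sqrt_le_sqrt hle)

end Fluctuation

/-! ### Conditional variance and conditional distribution function -/

section Model

variable {Ω : Type*} [MeasurableSpace Ω] {μ : Measure Ω} {n : ℕ}
  {f : unitInterval → unitInterval → ℝ} {L : ℝ} {ξ : Fin n → Ω → unitInterval}
  {A : Ω → Matrix (Fin n) (Fin n) ℝ} {h : ℕ} {j : Fin n} {i : {v : Fin n // v ≠ j}}

theorem IsGraphonModel.looFluct_eq (hA : IsGraphonModel μ f ξ A) :
    looFluct h f ξ A j i = fun ω => (h : ℝ)⁻¹ * fluctSum (adjOf (edgesOf (A ω))) (edgeProb f ξ ω)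
      (looNeighborhood h (adjOf (edgesOf (A ω))) j i) := by
  funext ω
  rw [hA.adjOf_edgesOf, looFluct, fluctSum]

theorem IsGraphonModel.measurable_looFluct (hA : IsGraphonModel μ f ξ A)
    (hf : IsLipschitzGraphon f L) : Measurable (looFluct h f ξ A j i) := by
  rw [hA.looFluct_eq]
  exact hA.measurable_of_edges hf (Ψ := fun c P => (h : ℝ)⁻¹ *
    fluctSum (adjOf c) P (looNeighborhood h (adjOf c) j i))
    fun c => (measurable_fluctSum _ _).const_mul _

theorem IsGraphonModel.measurable_looStd (hA : IsGraphonModel μ f ξ A)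
    (hf : IsLipschitzGraphon f L) : Measurable (looStd h f ξ A j i μ) := by
  refine (hA.measurable_looFluct hf).div (Measurable.sqrt ?_)
  exact stronglyMeasurable_condExp.measurable.mono (hA.measurable_looCond hf).comap_le le_rfl

variable [IsProbabilityMeasure μ]

theorem IsGraphonModel.condExp_looFluct (hA : IsGraphonModel μ f ξ A)
    (hf : IsLipschitzGraphon f L) :
    μ[looFluct h f ξ A j i | MeasurableSpace.comap (looCond h f ξ A j i) inferInstance]
      =ᵐ[μ] 0 := by
  rw [hA.looFluct_eq]
  refine hA.condExp_eq_zero hf (Ψ := fun c P => (h : ℝ)⁻¹ *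
    fluctSum (adjOf c) P (looNeighborhood h (adjOf c) j i)) (C := (h : ℝ)⁻¹ * n)
    (fun c => (measurable_fluctSum _ _).const_mul _) (fun c ω => ?_) fun ω S => ?_
  · rw [abs_mul, abs_of_nonneg (inv_nonneg.2 (Nat.cast_nonneg h))]
    refine mul_le_mul_of_nonneg_left ((abs_fluctSum_le (fun k l => hf.mem_Icc _ _) _ _).trans ?_)
      (inv_nonneg.2 (Nat.cast_nonneg h))
    exact_mod_cast (Finset.card_le_univ _).trans ((Fintype.card_subtype_le _).trans
      (Fintype.card_fin n).le)
  · simp only [mul_left_comm _ (h : ℝ)⁻¹]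
    rw [bernExp_const_mul, bernExp_fluctSum (P := edgeProb f ξ ω) fun k l => hf.symm _ _, mul_zero]

theorem IsGraphonModel.looVar_eq (hA : IsGraphonModel μ f ξ A) (hf : IsLipschitzGraphon f L) :
    looVar h f ξ A j i μ =ᵐ[μ] fun ω =>
      (h : ℝ)⁻¹ ^ 2 * varSum (edgeProb f ξ ω) (looNeighborhood h (A ω) j i) := by
  have hX : Measurable (looCond h f ξ A j i) := hA.measurable_looCond hf
  have hP01 : ∀ ω k l, edgeProb f ξ ω k l ∈ Set.Icc (0 : ℝ) 1 := fun ω k l => hf.mem_Icc _ _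
  have hcard : ∀ S : Finset {v : Fin n // v ≠ j}, (S.card : ℝ) ≤ n := fun S => by
    exact_mod_cast (Finset.card_le_univ _).trans ((Fintype.card_subtype_le _).trans
      (Fintype.card_fin n).le)
  have hsqb : ∀ c ω, |fluctSum (adjOf c) (edgeProb f ξ ω) (looNeighborhood h (adjOf c) j i) ^ 2|
      ≤ (n : ℝ) ^ 2 := fun c ω => by
    rw [abs_pow]
    exact pow_le_pow_left₀ (abs_nonneg _) ((abs_fluctSum_le (hP01 ω) _ _).trans (hcard _)) 2
  have hsqm : ∀ c, Measurable fun P => fluctSum (adjOf c) P (looNeighborhood h (adjOf c) j i) ^ 2 :=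
    fun c => (measurable_fluctSum _ _).pow_const 2
  have hvb : ∀ c ω, |varSum (edgeProb f ξ ω) (looNeighborhood h (adjOf c) j i)| ≤ n := fun c ω =>
    (abs_varSum_le (hP01 ω) _).trans (hcard _)
  have hvm : ∀ c : PossibleEdge n → Bool,
      Measurable fun P => varSum P (looNeighborhood h (adjOf c) j i) := fun c =>
    measurable_varSum _
  have hsqi := (hA.integrable_of_edges hf hsqm hsqb)
  have hvi := (hA.integrable_of_edges hf hvm hvb)
  have hzero := hA.condExp_eq_zero (h := h) (i := i) hf (Ψ := fun c P =>
    fluctSum (adjOf c) P (looNeighborhood h (adjOf c) j i) ^ 2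
      - varSum P (looNeighborhood h (adjOf c) j i)) (C := (n : ℝ) ^ 2 + n)
    (fun c => (hsqm c).sub (hvm c))
    (fun c ω => (abs_sub _ _).trans (add_le_add (hsqb c ω) (hvb c ω)))
    fun ω S => bernExp_fluctSum_sq (P := edgeProb f ξ ω) (fun k l => hf.symm _ _) S
  have hsub := condExp_sub hsqi hvi
    (MeasurableSpace.comap (looCond h f ξ A j i) inferInstance)
  -- The candidate variance is a function of the neighbourhood and `P` alone, so conditioning leaves
  -- it unchanged.
  have hvX : StronglyMeasurable[MeasurableSpace.comap (looCond h f ξ A j i) inferInstance]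
      fun ω => varSum (edgeProb f ξ ω) (looNeighborhood h (adjOf (edgesOf (A ω))) j i) := by
    have h1 : Measurable fun q : Finset {v : Fin n // v ≠ j} × (Fin n → Fin n → ℝ) =>
        varSum q.2 q.1 :=
      measurable_from_prod_countable_right (f := fun q : Finset {v : Fin n // v ≠ j} ×
        (Fin n → Fin n → ℝ) => varSum q.2 q.1) fun S => measurable_varSum S
    have h2 := (h1.comp (comap_measurable (looCond h f ξ A j i))).stronglyMeasurable
    simp only [hA.adjOf_edgesOf]
    exact h2
  have hvc := condExp_of_stronglyMeasurable hX.comap_le hvX hvi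
  -- Since the conditional mean vanishes, the conditional variance is the conditional second moment.
  have hfl : (looFluct h f ξ A j i - μ[looFluct h f ξ A j i |
      MeasurableSpace.comap (looCond h f ξ A j i) inferInstance]) ^ 2
      =ᵐ[μ] (h : ℝ)⁻¹ ^ 2 • fun ω => fluctSum (adjOf (edgesOf (A ω))) (edgeProb f ξ ω)
        (looNeighborhood h (adjOf (edgesOf (A ω))) j i) ^ 2 := by
    filter_upwards [hA.condExp_looFluct (h := h) (i := i) hf] with ω hω
    rw [Pi.pow_apply, Pi.sub_apply, hω, hA.looFluct_eq]
    simp [mul_pow]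
  have hcv := (condExp_congr_ae (m := MeasurableSpace.comap (looCond h f ξ A j i) inferInstance)
    hfl).trans (condExp_smul ((h : ℝ)⁻¹ ^ 2) _ _)
  filter_upwards [hcv, hzero, hsub] with ω e1 e2 e3
  rw [looVar, condVar, e1, Pi.smul_apply, smul_eq_mul]
  congr 1
  have e4 := e3.symm.trans e2
  rw [Pi.sub_apply, hvc, Pi.zero_apply, sub_eq_zero] at e4
  refine e4.trans ?_
  simp only [hA.adjOf_edgesOf]

theorem IsGraphonModel.looStd_eq (hA : IsGraphonModel μ f ξ A) (hf : IsLipschitzGraphon f L)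
    (h1 : 1 ≤ h) :
    looStd h f ξ A j i μ =ᵐ[μ] fun ω =>
      fluctSum (adjOf (edgesOf (A ω))) (edgeProb f ξ ω)
          (looNeighborhood h (adjOf (edgesOf (A ω))) j i)
        / √(varSum (edgeProb f ξ ω) (looNeighborhood h (adjOf (edgesOf (A ω))) j i)) := by
  filter_upwards [hA.looVar_eq (h := h) (i := i) hf] with ω hω
  have hh : (h : ℝ)⁻¹ ≠ 0 := inv_ne_zero (by positivity)
  rw [looStd, hω, hA.looFluct_eq, Real.sqrt_mul (sq_nonneg _), Real.sqrt_sq (by positivity),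
    mul_div_mul_left _ _ hh, hA.adjOf_edgesOf]

theorem IsGraphonModel.abs_condExp_sub_le (hA : IsGraphonModel μ f ξ A)
    (hf : IsLipschitzGraphon f L) {η : ℝ} (hη_pos : 0 < η) (hη_half : η < 1 / 2)
    (hfη : ∀ u v, η ≤ f u v ∧ f u v ≤ 1 - η) (h1 : 1 ≤ h) (hn : h + 2 ≤ n) (x : ℝ) :
    ∀ᵐ ω ∂μ, |(μ[(looStd h f ξ A j i μ ⁻¹' Set.Iic x).indicator fun _ => (1 : ℝ) |
        MeasurableSpace.comap (looCond h f ξ A j i) inferInstance]) ω - normalCDF x|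
      ≤ (√(η * (1 - η)))⁻¹ * ((normalPDF 1)⁻¹ + 3) * (h : ℝ) ^ (-(1 / 2) : ℝ) := by
  have hX : Measurable (looCond h f ξ A j i) := hA.measurable_looCond hf
  set B : ℝ := (√(η * (1 - η)))⁻¹ * ((normalPDF 1)⁻¹ + 3) * (h : ℝ) ^ (-(1 / 2) : ℝ) with hB
  have hK : 0 ≤ (normalPDF 1)⁻¹ + 3 := add_nonneg (inv_nonneg.2 (normalPDF_pos 1).le) (by norm_num)
  have hB0 : 0 ≤ B := by positivity
  set Ψ : (PossibleEdge n → Bool) → (Fin n → Fin n → ℝ) → ℝ := fun c P =>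
    Set.indicator (Set.Iic x) 1 (fluctSum (adjOf c) P (looNeighborhood h (adjOf c) j i)
        / √(varSum P (looNeighborhood h (adjOf c) j i))) - normalCDF x with hΨ
  have hΨm : ∀ c, Measurable (Ψ c) := fun c =>
    ((measurable_one.indicator measurableSet_Iic).comp
      ((measurable_fluctSum _ _).div (measurable_varSum _).sqrt)).sub_const _
  have hΨb : ∀ c P, |Ψ c P| ≤ 1 := by
    intro c P
    have h2 := normalCDF_nonneg x
    have h3 := normalCDF_le_one x
    simp only [hΨ, Set.indicator_apply, Pi.one_apply]
    rw [abs_le]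
    split_ifs <;> constructor <;> linarith
  have key : ∀ ω (S : Finset {v : Fin n // v ≠ j}),
      |bernExp (edgeParam (edgeProb f ξ ω)) (fun c =>
        (if looNeighborhood h (adjOf c) j i = S then 1 else 0) * Ψ c (edgeProb f ξ ω))|
      ≤ B * bernExp (edgeParam (edgeProb f ξ ω)) fun c =>
        if looNeighborhood h (adjOf c) j i = S then 1 else 0 := by
    intro ω S
    by_cases hS : S.card = h
    · obtain ⟨hv, hvB⟩ := inv_sqrt_varSum_le (P := edgeProb f ξ ω) hη_pos hη_half h1
        (fun k l => hfη _ _) hS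
      refine (abs_bernExp_fluctSum_indicator_le (P := edgeProb f ξ ω) (fun k l => hf.symm _ _)
        (fun k l => hf.mem_Icc _ _) S hv x).trans ?_
      refine mul_le_mul_of_nonneg_right ?_ ?_
      · calc _ ≤ _ := mul_le_mul_of_nonneg_right hvB hK
          _ = B := by rw [hB]; ring
      · have h0 := bernExp_mono (p := edgeParam (edgeProb f ξ ω)) (G := fun _ => 0)
          (H := fun c => if looNeighborhood h (adjOf c) j i = S then 1 else 0)
          (fun e => hf.mem_Icc _ _) fun c => by split_ifs <;> norm_num
        simpa [bernExp] using h0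
    -- A set of the wrong size is never the neighbourhood, so both sides vanish; the variance bound
    -- is needed only for `h` elements.
    · have h0 : ∀ c, looNeighborhood h (adjOf c) j i ≠ S := fun c hc =>
        hS (hc ▸ card_looNeighborhood hn _ _ _)
      simp [h0, bernExp]
  have hsplit : ∀ (a : ℝ) ω (S : Finset {v : Fin n // v ≠ j}),
      bernExp (edgeParam (edgeProb f ξ ω)) (fun c =>
        (if looNeighborhood h (adjOf c) j i = S then 1 else 0) * (B + a * Ψ c (edgeProb f ξ ω)))
      = B * bernExp (edgeParam (edgeProb f ξ ω)) (fun c =>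
        if looNeighborhood h (adjOf c) j i = S then 1 else 0)
      + a * bernExp (edgeParam (edgeProb f ξ ω)) (fun c =>
        (if looNeighborhood h (adjOf c) j i = S then 1 else 0) * Ψ c (edgeProb f ξ ω)) := by
    intro a ω S
    rw [← bernExp_const_mul, ← bernExp_const_mul, ← bernExp_add]
    congr 1; funext c; ring
  -- The two signs `a = 1` and `a = -1` turn the absolute bound into two instances of the sign
  -- criterion.
  have hcond : ∀ a : ℝ, |a| = 1 → 0 ≤ᵐ[μ] μ[fun ω => B + a * Ψ (edgesOf (A ω)) (edgeProb f ξ ω) |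
      MeasurableSpace.comap (looCond h f ξ A j i) inferInstance] := by
    intro a ha
    refine hA.condExp_nonneg hf (Ψ := fun c P => B + a * Ψ c P) (C := B + 1)
      (fun c => ((hΨm c).const_mul a).const_add B) (fun c ω => ?_) fun ω S => ?_
    · refine (abs_add_le _ _).trans (add_le_add (abs_of_nonneg hB0).le ?_)
      rw [abs_mul, ha, one_mul]
      exact hΨb _ _
    · rw [hsplit]
      have h2 := abs_mul a (bernExp (edgeParam (edgeProb f ξ ω)) (fun c =>
        (if looNeighborhood h (adjOf c) j i = S then 1 else 0) * Ψ c (edgeProb f ξ ω)))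
      rw [ha, one_mul] at h2
      linarith [key ω S, neg_abs_le (a * bernExp (edgeParam (edgeProb f ξ ω)) (fun c =>
        (if looNeighborhood h (adjOf c) j i = S then 1 else 0) * Ψ c (edgeProb f ξ ω)))]
  have hset : MeasurableSet (looStd h f ξ A j i μ ⁻¹' Set.Iic x) :=
    hA.measurable_looStd hf measurableSet_Iic
  have hI : Integrable ((looStd h f ξ A j i μ ⁻¹' Set.Iic x).indicator fun _ => (1 : ℝ)) μ :=
    (integrable_const 1).indicator hset
  have hlin : ∀ a : ℝ, μ[fun ω => B + a * Ψ (edgesOf (A ω)) (edgeProb f ξ ω) |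
      MeasurableSpace.comap (looCond h f ξ A j i) inferInstance] =ᵐ[μ]
      fun ω => (B - a * normalCDF x) + a *
        (μ[(looStd h f ξ A j i μ ⁻¹' Set.Iic x).indicator fun _ => (1 : ℝ) |
        MeasurableSpace.comap (looCond h f ξ A j i) inferInstance]) ω := by
    intro a
    have e1 : (fun ω => B + a * Ψ (edgesOf (A ω)) (edgeProb f ξ ω)) =ᵐ[μ]
        (fun _ => B - a * normalCDF x) +
          a • (looStd h f ξ A j i μ ⁻¹' Set.Iic x).indicator fun _ => (1 : ℝ) := by
      filter_upwards [hA.looStd_eq (i := i) hf h1] with ω hω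
      have e2 : (looStd h f ξ A j i μ ⁻¹' Set.Iic x).indicator (fun _ => (1 : ℝ)) ω
          = Set.indicator (Set.Iic x) 1 (looStd h f ξ A j i μ ω) := rfl
      rw [Pi.add_apply, Pi.smul_apply, smul_eq_mul, e2, hω]
      simp only [hΨ]
      ring
    refine (condExp_congr_ae e1).trans ((condExp_add (integrable_const _) (hI.smul a) _).trans ?_)
    filter_upwards [condExp_smul a ((looStd h f ξ A j i μ ⁻¹' Set.Iic x).indicator
      fun _ => (1 : ℝ)) (MeasurableSpace.comap (looCond h f ξ A j i) inferInstance) (μ := μ)]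
      with ω hω
    rw [Pi.add_apply, hω, condExp_const hX.comap_le, Pi.smul_apply, smul_eq_mul]
  filter_upwards [hcond 1 (by simp), hcond (-1) (by simp), hlin 1, hlin (-1)] with ω a1 a2 a3 a4
  rw [a3, Pi.zero_apply] at a1
  rw [a4, Pi.zero_apply] at a2
  rw [abs_le]
  constructor <;> linarith

end Model

/-! ### Uniformity in the threshold -/

/-- Two distribution functions that are close at the rationals are close everywhere. -/
theorem abs_real_Iic_sub_cdf_le_of_rat {ν ρ : Measure ℝ} [IsProbabilityMeasure ν]
    [IsProbabilityMeasure ρ] {B : ℝ}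
    (h : ∀ q : ℚ, |ν.real (Set.Iic (q : ℝ)) - cdf ρ q| ≤ B) (x : ℝ) :
    |ν.real (Set.Iic x) - cdf ρ x| ≤ B := by
  simp only [← cdf_eq_real] at h ⊢
  obtain ⟨u, -, hu, hlim⟩ := Real.exists_seq_rat_strictAnti_tendsto x
  have hw : Filter.Tendsto (fun n => (u n : ℝ)) Filter.atTop (nhdsWithin x (Set.Ici x)) :=
    tendsto_nhdsWithin_iff.2 ⟨hlim, Filter.Eventually.of_forall fun n => (hu n).le⟩
  exact le_of_tendsto ((((cdf ν).right_continuous x).tendsto.comp hw).sub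
    (((cdf ρ).right_continuous x).tendsto.comp hw)).abs
    (Filter.Eventually.of_forall fun n => h (u n))

theorem theorem3p2 (η : ℝ) (hη_pos : 0 < η) (hη_half : η < 1 / 2) :
    ∃ C : ℝ, 0 < C ∧
      ∀ (Ω : Type*) [MeasurableSpace Ω] (μ : Measure Ω) [IsProbabilityMeasure μ]
        (n h : ℕ) (L : ℝ) (f : unitInterval → unitInterval → ℝ)
        (ξ : Fin n → Ω → unitInterval) (A : Ω → Matrix (Fin n) (Fin n) ℝ),
        1 ≤ h → h + 2 ≤ n →
        IsLipschitzGraphon f L →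
        (∀ u v, η ≤ f u v ∧ f u v ≤ 1 - η) →
        IsGraphonModel μ f ξ A →
        ∀ᵐ ω ∂μ, ∀ (j : Fin n) (i : {v : Fin n // v ≠ j}) (x : ℝ),
          |(condDistrib (looStd h f ξ A j i μ) (looCond h f ξ A j i) μ
                (looCond h f ξ A j i ω)).real (Set.Iic x)
              - cdf (gaussianReal 0 1) x|
            ≤ C * (h : ℝ) ^ (-(1 / 2) : ℝ) := by
  refine ⟨(√(η * (1 - η)))⁻¹ * ((normalPDF 1)⁻¹ + 3), ?_, ?_⟩
  · have h1 : 0 < √(η * (1 - η)) := Real.sqrt_pos.2 (mul_pos hη_pos (by linarith))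
    have h2 := normalPDF_pos 1
    positivity
  intro Ω _ μ _ n h L f ξ A h1 hn hf hfη hA
  rw [ae_all_iff]
  intro j
  rw [ae_all_iff]
  intro i
  -- The exceptional null set depends on the threshold; restricting to rationals keeps the union of
  -- these sets null.
  have hq : ∀ᵐ ω ∂μ, ∀ q : ℚ, |(condDistrib (looStd h f ξ A j i μ) (looCond h f ξ A j i) μ
      (looCond h f ξ A j i ω)).real (Set.Iic (q : ℝ)) - cdf (gaussianReal 0 1) q|
        ≤ (√(η * (1 - η)))⁻¹ * ((normalPDF 1)⁻¹ + 3) * (h : ℝ) ^ (-(1 / 2) : ℝ) := by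
    rw [ae_all_iff]
    intro q
    filter_upwards [condDistrib_ae_eq_condExp (hA.measurable_looCond (h := h) (i := i) hf)
      (hA.measurable_looStd (h := h) (i := i) hf) (measurableSet_Iic (a := (q : ℝ))),
      hA.abs_condExp_sub_le (h := h) (i := i) hf hη_pos hη_half hfη h1 hn q] with ω e1 e2
    rw [e1]
    exact e2
  filter_upwards [hq] with ω hω x
  exact abs_real_Iic_sub_cdf_le_of_rat hω x
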